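/- Let $\mathbb{D}$ be the open unit disk and $\mathcal{H}$ the set of analytic functions on $\mathbb{D}$. For $f,g\in\mathcal{H}$ write $f\prec g$ if $f=g\circ w$ on $\mathbb{D}$ for some $w\in\mathcal{H}$ with $w(0)=0$ and $|w|<1$. Put $\varphi_{Ne}(z)=1+z-z^3/3$. **Theorem.** Let $\beta$ be real and let $p\in\mathcal{H}$ satisfy $p(0)=1$ and $1+\beta zp'(z)\prec\varphi_{Ne}(z)$. Then: (a) $p(z)\prec\varphi_{\mathrm{cr}}(z)=\sqrt{1+z^2}+z$ (principal branch) whenever $\beta\ge\frac49(2+\sqrt2)$; (b) $p(z)\prec\varphi_C(z)=1+\frac43z+\frac23z^2$ whenever $\beta\ge\frac43$; (c) $p(z)\prec\varphi_{lim}(z)=1+\sqrt2\,z+\frac12z^2$ whenever $\beta\ge\frac{16}{63}(1+2\sqrt2)$; (d) $p(z)\prec e^z$ whenever $\beta\ge\frac{8e}{9(e-1)}$; (e) $p(z)\prec\varphi_S(z)=1+\sin z$ whenever $\beta\ge\frac{8}{9\sin1}$; (f) $p(z)\prec\varphi_0(z)=1+\frac zk\cdot\frac{k+z}{k-z}$,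 $k=1+\sqrt2$, whenever $\beta\ge\frac89(3+2\sqrt2)$; (g) $p(z)\prec\varphi_{Ne}(z)$ whenever $\beta\ge\frac43$. The bounds on $\beta$ are sharp: if $b$ is the bound in one of the parts and $0<\beta<b$, then some $p\in\mathcal{H}$ with $p(0)=1$ and $1+\beta zp'(z)\prec\varphi_{Ne}(z)$ violates the conclusion of that part. **Corollary.** Let $\mathcal{A}$ be the set of $f\in\mathcal{H}$ with $f(0)=0$ and $f'(0)=1$, and for $\varphi\in\mathcal{H}$ let $\mathcal{S}^*(\varphi)$ be the set of $f\in\mathcal{A}$ with $zf'(z)/f(z)\prec\varphi(z)$. If $\beta$ is real and $f\in\mathcal{A}$ satisfies $$1+\beta\,\frac{zf'(z)}{f(z)}\left(1-\frac{zf'(z)}{f(z)}+\frac{zf''(z)}{f'(z)}\right)\prec\varphi_{Ne}(z)$$ (the left side being understood as a meromorphic function on $\mathbb{D}$ with its removable singularities removed), then $f\in\mathcal{S}^*(\varphi)$ in each of the following cases: (a) $\varphi=\varphi_{\mathrm{cr}}$ and $\beta\ge\frac{8}{9(2-\sqrt2)}$; (b) $\varphi=\varphi_C$ and $\beta\ge\frac43$;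 (c) $\varphi=\varphi_{lim}$ and $\beta\ge\frac{16}{9(2\sqrt2-1)}$; (d) $\varphi=\exp$ and $\beta\ge\frac{8e}{9(e-1)}$; (e) $\varphi=\varphi_S$ and $\beta\ge\frac{8}{9\sin1}$; (f) $\varphi=\varphi_0$ and $\beta\ge\frac89(3+2\sqrt2)$; (g) $\varphi=\varphi_{Ne}$ and $\beta\ge\frac43$. These bounds are best possible: for each part with bound $b$ and each $0<\beta<b$, some $f\in\mathcal{A}$ satisfies the hypothesis for this $\beta$ but is not in the corresponding class. -/

import Mathlib

open Set Metric

noncomputable section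

namespace Nephroid

/-- The open unit disk of the complex plane. -/
abbrev unitDisk : Set ℂ := ball (0 : ℂ) 1

/-- `f` belongs to the collection of analytic functions on the unit disk. Functions are total on `ℂ`;
only their values in the disk matter. -/
def IsHolo (f : ℂ → ℂ) : Prop := DifferentiableOn ℂ f unitDisk

/-- A Schwarz function: analytic in the unit disk, `w 0 = 0`, and `‖w z‖ < 1` there. -/
def IsSchwarz (w : ℂ → ℂ) : Prop :=
  IsHolo w ∧ w 0 = 0 ∧ ∀ z ∈ unitDisk, ‖w z‖ < 1

/-- Subordination `f ≺ g` of two analytic functions on the unit disk. -/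
def Subordinate (f g : ℂ → ℂ) : Prop :=
  IsHolo f ∧ IsHolo g ∧ ∃ w : ℂ → ℂ, IsSchwarz w ∧ ∀ z ∈ unitDisk, f z = g (w z)

/-- The normalized analytic functions: `f 0 = 0` and `f' 0 = 1`. -/
def ClassA : Set (ℂ → ℂ) := {f | IsHolo f ∧ f 0 = 0 ∧ deriv f 0 = 1}

/-- The quotient `z f'(z) / f(z)` for `f ∈ ClassA`, with its limit `1` at the origin.
At a zero `z₀ ≠ 0` of `f` the quotient has a pole, so this function is discontinuous there and
requiring it to be analytic in the disk excludes such zeros. -/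
def starQuot (f : ℂ → ℂ) (z : ℂ) : ℂ := if z = 0 then 1 else z * deriv f z / f z

/-- The Ma-Minda class of all `f ∈ ClassA` with `z f'(z) / f(z) ≺ φ(z)`. -/
def StarlikeClass (φ : ℂ → ℂ) : Set (ℂ → ℂ) := {f | f ∈ ClassA ∧ Subordinate (starQuot f) φ}

/-- The nephroid function. -/
def phiNe (z : ℂ) : ℂ := 1 + z - z ^ 3 / 3

/-- The crescent function `√(1 + z²) + z`, with the principal branch
(`1 + z²` has positive real part in the disk). -/
def phiCrescent (z : ℂ) : ℂ := (1 + z ^ 2) ^ (1 / 2 : ℂ) + z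

/-- The cardioid function. -/
def phiC (z : ℂ) : ℂ := 1 + 4 / 3 * z + 2 / 3 * z ^ 2

/-- The limaçon function. -/
def phiLim (z : ℂ) : ℂ := 1 + ((√2 : ℝ) : ℂ) * z + 1 / 2 * z ^ 2

/-- The function `1 + sin z`. -/
def phiS (z : ℂ) : ℂ := 1 + Complex.sin z

/-- The constant `k = 1 + √2`. -/
def kR : ℂ := 1 + ((√2 : ℝ) : ℂ)

/-- The rational function `1 + (z / k) (k + z) / (k - z)` with `k = 1 + √2`. -/
def phiR (z : ℂ) : ℂ := 1 + z / kR * ((kR + z) / (kR - z))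

/-- For every analytic `p` with `p 0 = 1`: if `1 + β z p'(z) ≺ phiNe(z)`, then `p ≺ φ`. -/
def DiffImplies (φ : ℂ → ℂ) (β : ℝ) : Prop :=
  ∀ p : ℂ → ℂ, IsHolo p → p 0 = 1 →
    Subordinate (fun z => 1 + (β : ℂ) * (z * deriv p z)) phiNe → Subordinate p φ

/-- The hypothesis
`1 + β (z f'(z) / f(z)) (1 - z f'(z) / f(z) + z f''(z) / f'(z)) ≺ phiNe(z)`.
The left side is a meromorphic function in the disk, and the identity with `phiNe ∘ w` is required
at the points where all its quotients are defined, that is, off the discrete set of zeros of `f` and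
`f'`; at these exceptional points (among them the origin) the singularity is then removable. -/
def StarHypothesis (β : ℝ) (f : ℂ → ℂ) : Prop :=
  ∃ w : ℂ → ℂ, IsSchwarz w ∧ ∀ z ∈ unitDisk, f z ≠ 0 → deriv f z ≠ 0 →
    1 + (β : ℂ) * (z * deriv f z / f z) *
      (1 - z * deriv f z / f z + z * deriv (deriv f) z / deriv f z) = phiNe (w z)

/-- Every `f ∈ ClassA` satisfying `StarHypothesis β` belongs to the class attached to `φ`. -/
def StarImplies (φ : ℂ → ℂ) (β : ℝ) : Prop :=
  ∀ f ∈ ClassA, StarHypothesis β f → f ∈ StarlikeClass φ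

/-- `P β` holds for all `β ≥ b`, and the bound is sharp: `P β` fails for all `0 < β < b`. -/
def HoldsWithSharpBound (P : ℝ → Prop) (b : ℝ) : Prop :=
  (∀ β : ℝ, b ≤ β → P β) ∧ ∀ β : ℝ, 0 < β → β < b → ¬ P β

end Nephroid

end

namespace Nephroid

/-! The equation βzq' = z - z³/3, q(0) = 1, has the solution q = 1 + (z - z³/9)/β = 1 + (8/(9β))G,
where G = (9z - z³)/8 is normalized by G(±1) = ±1. Two facts give the implications: an admissible p
is subordinate to 1 + cG as soon as β ≥ 8/(9c), and 1 + cG ≺ φ for c = 1 - φ(-1). With this c the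
point 1 + cG(-1) is exactly φ(-1), and 8/(9c) is the asserted bound. For smaller β > 0 the function
q already takes the value φ(-1) at a real point inside the disk, while φ omits that value there;
hence sharpness.

The first fact is `exists_schwarz_of_mul_deriv_eq`. A multiple P of p - 1 is written as v - v³/9
with v explicit. If |v| reached 1, then at a first such point Jack's lemma would give z₀v'(z₀) = m
v(z₀) with m ≥ 1, and the differential equation would make a multiple, by a real factor at least 1,
of a boundary value of h(z) = z - z³/3 equal to a value of h inside the disk. Starlikeness of h
forbids this.

For the second fact, φ has an explicit inverse branch on 1 + cG(𝔻), giving an analytic W with W(0) =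
0 and φ ∘ W = 1 + cG. By connectedness it is enough that |W| is never 1, that is, that this image
misses the relevant values of φ on the unit circle. For the algebraic φ the bounds |Re G| < 1
(deciding near -1) and |G| < 5/4 (deciding elsewhere) suffice. The sine also needs an elliptic
bound, and the exponential a fourth-order comparison at the tangency point.

For the corollary, p = zf'/f turns the hypothesis into the one on p, once a double-pole argument
shows that f vanishes only at 0. The extremal functions integrate zf'/f = q. -/

/-- The function `G` for which `1 + (8 / (9 β)) G` is the best dominant. -/
noncomputable def cubicG (z : ℂ) : ℂ := (9 * z - z ^ 3) / 8

/-! ### Estimates for the image of the disk under `cubicG` -/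

lemma re_sq_add_im_sq_lt_one {z : ℂ} (hz : z ∈ unitDisk) : z.re ^ 2 + z.im ^ 2 < 1 := by
  rw [mem_ball_zero_iff] at hz
  have h := Complex.sq_norm z
  rw [Complex.normSq_apply] at h
  nlinarith [norm_nonneg z]

lemma re_sq_add_im_sq_eq_one {z : ℂ} (hz : ‖z‖ = 1) : z.re ^ 2 + z.im ^ 2 = 1 := by
  have h := Complex.sq_norm z
  rw [Complex.normSq_apply, hz] at h
  linarith

lemma cubicG_re (z : ℂ) : (cubicG z).re = z.re * (9 - z.re ^ 2 + 3 * z.im ^ 2) / 8 := by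
  have : cubicG z = ((1 / 8 : ℝ) : ℂ) * (9 * z - z ^ 3) := by
    unfold cubicG; push_cast; ring
  rw [this, Complex.re_ofReal_mul]
  simp [pow_succ]
  ring

lemma cubicG_im (z : ℂ) : (cubicG z).im = z.im * (9 - 3 * z.re ^ 2 + z.im ^ 2) / 8 := by
  have : cubicG z = ((1 / 8 : ℝ) : ℂ) * (9 * z - z ^ 3) := by
    unfold cubicG; push_cast; ring
  rw [this, Complex.im_ofReal_mul]
  simp [pow_succ]
  ring

/-- For fixed x = Re z the modulus of Re G grows with (Im z)², so it is at most the value at (Im z)²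
= 1 - x². -/
lemma abs_cubicG_re_le {z : ℂ} (hz : z ∈ unitDisk) :
    |(cubicG z).re| ≤ |z.re| * (3 - z.re ^ 2) / 2 := by
  have h := re_sq_add_im_sq_lt_one hz
  rw [cubicG_re, abs_div, abs_mul, abs_of_pos (a := 9 - z.re ^ 2 + 3 * z.im ^ 2) (by nlinarith),
    abs_of_pos (a := (8 : ℝ)) (by norm_num)]
  have := mul_le_mul_of_nonneg_left (a := |z.re|)
    (show 9 - z.re ^ 2 + 3 * z.im ^ 2 ≤ 4 * (3 - z.re ^ 2) by linarith) (abs_nonneg _)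
  linarith

lemma abs_cubicG_re_lt {z : ℂ} (hz : z ∈ unitDisk) : |(cubicG z).re| < 1 := by
  refine (abs_cubicG_re_le hz).trans_lt ?_
  have h := re_sq_add_im_sq_lt_one hz
  rw [← sq_abs z.re] at h ⊢
  have h0 := abs_nonneg z.re
  have h1 : |z.re| < 1 := by nlinarith [sq_nonneg z.im]
  nlinarith [mul_pos (mul_pos (sub_pos.2 h1) (sub_pos.2 h1)) (by linarith : 0 < 2 + |z.re|)]

/-- The right side is |G|² at the point of the unit circle with the same real part. Its maximum
25/16 is |G(i)|². -/
lemma normSq_cubicG_lt {z : ℂ} (hz : z ∈ unitDisk) :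
    (cubicG z).re ^ 2 + (cubicG z).im ^ 2 < (25 - 9 * z.re ^ 2) / 16 := by
  have h := re_sq_add_im_sq_lt_one hz
  rw [cubicG_re, cubicG_im]
  set A := z.re ^ 2
  set B := z.im ^ 2
  have hA : 0 ≤ A := sq_nonneg _
  have hB : 0 ≤ B := sq_nonneg _
  have e : (z.re * (9 - A + 3 * B) / 8) ^ 2 + (z.im * (9 - 3 * A + B) / 8) ^ 2 =
      (A + B) * (81 - 18 * A + 18 * B + (A + B) ^ 2) / 64 := by
    simp only [A, B]; ring
  rw [e]
  have h2 : 81 - 18 * A + 18 * B + (A + B) ^ 2 < 81 - 18 * A + 18 * (1 - A) + 1 := by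
    nlinarith
  have h3 : 0 < 81 - 18 * A + 18 * B + (A + B) ^ 2 := by nlinarith
  nlinarith

lemma normSq_cubicG_lt_const {z : ℂ} (hz : z ∈ unitDisk) :
    (cubicG z).re ^ 2 + (cubicG z).im ^ 2 < 25 / 16 := by
  have := normSq_cubicG_lt hz
  nlinarith [sq_nonneg z.re]

/-- With A = (Re z)², the bounds for |G|² and (Re G)² add up to 7/4 - (A - 1/2)²(3/4 - 3A/20). The
weight 3/5 serves the sine, where neither the strip nor the disk bound suffices in the middle range.
-/
lemma cubicG_ellipse {z : ℂ} (hz : z ∈ unitDisk) :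
    (cubicG z).re ^ 2 + (cubicG z).im ^ 2 + 3 / 5 * (cubicG z).re ^ 2 < 7 / 4 := by
  have h := normSq_cubicG_lt hz
  have h2 := abs_cubicG_re_le hz
  have h3 := re_sq_add_im_sq_lt_one hz
  have h4 : (cubicG z).re ^ 2 ≤ z.re ^ 2 * (3 - z.re ^ 2) ^ 2 / 4 := by
    have := pow_le_pow_left₀ (abs_nonneg _) h2 2
    rw [sq_abs, div_pow, mul_pow, sq_abs] at this
    linarith
  have hA : 0 ≤ z.re ^ 2 := sq_nonneg _
  have hA1 : z.re ^ 2 ≤ 1 := by nlinarith [sq_nonneg z.im]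
  generalize z.re ^ 2 = A at *
  nlinarith [mul_nonneg (sq_nonneg (A - 1 / 2)) (by linarith : 0 ≤ 3 / 4 - 3 / 20 * A)]

lemma cubicG_quartic_bound_aux {a : ℝ} (h0 : 0 ≤ a) (h1 : a ≤ 1) :
    3 / 10 * ((1 - a ^ 2) * (5 - 2 * a ^ 2) ^ 2 / 16) ^ 2 ≤ 1 - a * (3 - a ^ 2) / 2 := by
  -- Both sides carry the factor (1 - a)², because 1 - a(3 - a²)/2 = (1 - a)²(2 + a)/2; `key` is
  -- what remains after division.
  have key : 3 * ((1 + a) * (5 - 2 * a ^ 2) ^ 2) ^ 2 ≤ 1280 * (2 + a) := by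
    have hm0 : 0 ≤ (1 + a) * (5 - 2 * a ^ 2) ^ 2 := by positivity
    rcases le_total a (3 / 10) with ha | ha
    · have hm : (1 + a) * (5 - 2 * a ^ 2) ^ 2 ≤ 256 / 10 + 177 / 10 * a := by
        nlinarith [mul_nonneg h0 (sq_nonneg (a - 3 / 20)), sq_nonneg (a - 3 / 20),
          mul_nonneg (mul_nonneg h0 h0) (sq_nonneg (a - 3 / 20)), mul_nonneg h0 (sub_nonneg.2 ha),
          mul_nonneg (mul_nonneg (mul_nonneg h0 h0) h0) (sub_nonneg.2 ha)]
      have := pow_le_pow_left₀ hm0 hm 2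
      nlinarith
    · have hm : (1 + a) * (5 - 2 * a ^ 2) ^ 2 ≤ 31 := by
        nlinarith [mul_nonneg h0 (sq_nonneg (a - 1 / 3)), sq_nonneg (a - 1 / 3),
          mul_nonneg (mul_nonneg h0 h0) (sq_nonneg (a - 1 / 3)), mul_nonneg h0 (sub_nonneg.2 h1),
          mul_nonneg (mul_nonneg (mul_nonneg h0 h0) h0) (sub_nonneg.2 h1),
          mul_nonneg (mul_nonneg (mul_nonneg h0 h0) h0) (sq_nonneg (a - 1 / 3))]
      have := pow_le_pow_left₀ hm0 hm 2
      nlinarith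
  have := mul_le_mul_of_nonneg_left key (sq_nonneg (1 - a))
  linear_combination (1 / 2560) * this

/-- The image of `cubicG` is flat to third order at its leftmost point. -/
lemma cubicG_quartic_bound {z : ℂ} (hz : z ∈ unitDisk) :
    -1 + 3 / 10 * (cubicG z).im ^ 4 < (cubicG z).re := by
  have h3 := re_sq_add_im_sq_lt_one hz
  have h2 := (abs_le.1 (abs_cubicG_re_le hz)).1
  have hB : 0 ≤ z.im ^ 2 := sq_nonneg _
  have h4 : (cubicG z).im ^ 2 < (1 - z.re ^ 2) * (5 - 2 * z.re ^ 2) ^ 2 / 16 := by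
    have e : (cubicG z).im ^ 2 = z.im ^ 2 * (9 - 3 * z.re ^ 2 + z.im ^ 2) ^ 2 / 64 := by
      rw [cubicG_im]; ring
    have hA : 0 ≤ z.re ^ 2 := sq_nonneg _
    rw [e]
    generalize z.re ^ 2 = A at *
    generalize z.im ^ 2 = B at *
    have h5 : (9 - 3 * A + B) ^ 2 ≤ (2 * (5 - 2 * A)) ^ 2 :=
      pow_le_pow_left₀ (by linarith) (by linarith) 2
    have h6 : 0 < (2 * (5 - 2 * A)) ^ 2 := pow_pos (by linarith) 2
    nlinarith
  have h5 := pow_lt_pow_left₀ h4 (sq_nonneg _) two_ne_zero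
  have h6 := cubicG_quartic_bound_aux (abs_nonneg z.re)
    (by rw [← abs_one, ← sq_le_sq]; nlinarith)
  rw [sq_abs] at h6
  nlinarith

lemma norm_lt_one_on_ball {v : ℂ → ℂ} {r : ℝ} (hv : ContinuousOn v (ball 0 r)) (h0 : v 0 = 0)
    (h : ∀ z ∈ ball (0 : ℂ) r, ‖v z‖ ≠ 1) {z : ℂ} (hz : z ∈ ball (0 : ℂ) r) : ‖v z‖ < 1 := by
  by_contra! hz1
  have hc : IsPreconnected (ball (0 : ℂ) r) := (convex_ball (0 : ℂ) r).isPreconnected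
  have hr : 0 < r := (norm_nonneg z).trans_lt (mem_ball_zero_iff.1 hz)
  obtain ⟨y, hy, hy1⟩ := hc.intermediate_value (mem_ball_self hr) hz hv.norm
    (show (1 : ℝ) ∈ Icc ‖v 0‖ ‖v z‖ by simp [h0, hz1])
  exact h y hy hy1

/-- The disk is connected and |w(0)| = 0, so |w| cannot exceed 1 without taking the value 1. -/
lemma isSchwarz_of_norm_ne_one {w : ℂ → ℂ} (hw : IsHolo w) (h0 : w 0 = 0)
    (h : ∀ z ∈ unitDisk, ‖w z‖ ≠ 1) : IsSchwarz w :=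
  ⟨hw, h0, fun _ hz => norm_lt_one_on_ball hw.continuousOn h0 h hz⟩

/-! ### Sine and exponential on the unit circle -/

lemma sq_mul_le_sin_sq {x : ℝ} (hx : x ^ 2 ≤ 1) :
    x ^ 2 * (1 - x ^ 2 / 6) ^ 2 ≤ Real.sin x ^ 2 := by
  have h : |x| - |x| ^ 3 / 6 ≤ Real.sin |x| := Real.sin_ge_sub_cube (abs_nonneg x)
  have h1 : |x| ≤ 1 := by rw [← abs_one, ← sq_le_sq]; simpa using hx
  have h2 : Real.sin |x| ^ 2 = Real.sin x ^ 2 := by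
    rcases abs_choice x with e | e
    · rw [e]
    · rw [e]; simp
  have h0 := abs_nonneg x
  rw [← h2, ← sq_abs x]
  have h3 : 0 ≤ |x| - |x| ^ 3 / 6 := by nlinarith [mul_nonneg h0 h0]
  calc |x| ^ 2 * (1 - |x| ^ 2 / 6) ^ 2 = (|x| - |x| ^ 3 / 6) ^ 2 := by ring
    _ ≤ _ := pow_le_pow_left₀ h3 h 2

lemma sq_le_sinh_sq (y : ℝ) : y ^ 2 ≤ Real.sinh y ^ 2 := by
  have h : |y| ≤ Real.sinh |y| := Real.self_le_sinh_iff.2 (abs_nonneg y)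
  have h2 : Real.sinh |y| ^ 2 = Real.sinh y ^ 2 := by
    rcases abs_choice y with e | e
    · rw [e]
    · rw [e]; simp
  rw [← h2, ← sq_abs y]
  exact pow_le_pow_left₀ (abs_nonneg _) h 2

lemma sq_add_le_sinh_sq (y : ℝ) : y ^ 2 + y ^ 4 / 4 ≤ Real.sinh y ^ 2 := by
  have h := sq_le_sinh_sq (y / 2)
  have h2 : Real.sinh y = 2 * Real.sinh (y / 2) * Real.cosh (y / 2) := by
    rw [← Real.sinh_two_mul]; ring_nf
  have h3 := Real.cosh_sq (y / 2)
  rw [h2, mul_pow, mul_pow, h3]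
  nlinarith [sq_nonneg y]

lemma sin_one_bounds : 5 / 6 ≤ Real.sin 1 ∧ Real.sin 1 ≤ 253 / 300 := by
  have h := abs_le.1 (Real.sin_bound (x := 1) (by simp))
  have h1 := Real.sin_ge_sub_cube (x := 1) (by norm_num)
  norm_num at h h1 ⊢
  constructor <;> linarith [h.1, h.2]

lemma cos_one_upper : Real.cos 1 ≤ 53 / 96 := by
  have h := (abs_le.1 (Real.cos_bound (x := 1) (by simp))).2
  norm_num at h
  linarith

/-- Points of the sphere near the real axis are sent by `sin` out of the strip
`|Re u| < sin 1`. -/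
lemma sin_one_sq_le {x y : ℝ} (h : x ^ 2 + y ^ 2 = 1) (hx : (17 / 20 : ℝ) ^ 2 ≤ x ^ 2) :
    Real.sin 1 ^ 2 ≤ Real.sin x ^ 2 * (1 + Real.sinh y ^ 2) := by
  obtain ⟨hs, hs'⟩ := sin_one_bounds
  have hc := cos_one_upper
  have h2 : Real.sin |x| ^ 2 = Real.sin x ^ 2 := by
    rcases abs_choice x with e | e
    · rw [e]
    · rw [e]; simp
  rw [sq_le_sq, abs_of_pos (by norm_num)] at hx
  have hx1 : |x| ≤ 1 := by rw [← abs_one, ← sq_le_sq]; nlinarith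
  obtain ⟨d, hd⟩ : ∃ d, |x| = 1 - d := ⟨1 - |x|, by ring⟩
  have hd0 : 0 ≤ d := by linarith
  have hd1 : d ≤ 3 / 20 := by linarith
  have hy : y ^ 2 = 2 * d - d ^ 2 := by
    rw [← sq_abs x, hd] at h; linarith
  have hsin : Real.sin 1 * (1 - d ^ 2 / 2) - Real.cos 1 * d ≤ Real.sin |x| := by
    rw [hd, Real.sin_sub]
    have h3 := Real.one_sub_sq_div_two_le_cos (x := d)
    have h4 := Real.sin_le hd0
    have h5 := Real.cos_one_pos
    nlinarith
  -- 67/100 is an upper bound for cot 1, by the bounds on sin 1 and cos 1.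
  have hL : Real.sin 1 * (1 - 67 / 100 * d - d ^ 2 / 2) ≤ Real.sin |x| := by nlinarith
  have hL0 : 0 ≤ 1 - 67 / 100 * d - d ^ 2 / 2 := by nlinarith
  have hL2 := pow_le_pow_left₀ (mul_nonneg (by linarith) hL0) hL 2
  have hsh := sq_le_sinh_sq y
  rw [← h2]
  have hp : 1 ≤ (1 - 67 / 100 * d - d ^ 2 / 2) ^ 2 * (1 + (2 * d - d ^ 2)) := by
    nlinarith [mul_nonneg hd0 (sub_nonneg.2 hd1), mul_nonneg (mul_nonneg hd0 hd0) (sub_nonneg.2 hd1),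
      mul_nonneg (mul_nonneg (mul_nonneg hd0 hd0) hd0) (sub_nonneg.2 hd1), mul_nonneg (mul_nonneg (mul_nonneg (mul_nonneg hd0 hd0) hd0) hd0) (sub_nonneg.2 hd1)]
  calc Real.sin 1 ^ 2 ≤ Real.sin 1 ^ 2 *
        ((1 - 67 / 100 * d - d ^ 2 / 2) ^ 2 * (1 + (2 * d - d ^ 2))) :=
        le_mul_of_one_le_right (sq_nonneg _) hp
    _ = (Real.sin 1 * (1 - 67 / 100 * d - d ^ 2 / 2)) ^ 2 * (1 + y ^ 2) := by rw [hy]; ring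
    _ ≤ _ := by gcongr

/-- Since |sin w|² = sin²x + sinh²y and (Re sin w)² = sin²x cosh²y, this puts sin w on or outside
the ellipse of `cubicG_ellipse` scaled by sin 1. It covers the part of the circle away from ±1. -/
lemma sin_ellipse_bound {x y : ℝ} (h : x ^ 2 + y ^ 2 = 1) (hx : x ^ 2 ≤ (17 / 20 : ℝ) ^ 2) :
    7 / 4 * Real.sin 1 ^ 2 ≤ Real.sin x ^ 2 + Real.sinh y ^ 2 +
      3 / 5 * (Real.sin x ^ 2 * (1 + Real.sinh y ^ 2)) := by
  obtain ⟨hs, hs'⟩ := sin_one_bounds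
  have h1 := pow_le_pow_left₀ (by linarith) hs' 2
  have h2 := sq_mul_le_sin_sq (x := x) (by nlinarith)
  have h3 := sq_add_le_sinh_sq y
  have e4 : y ^ 4 = (y ^ 2) ^ 2 := by ring
  rw [e4] at h3
  have hX0 := sq_nonneg x
  have hY : y ^ 2 = 1 - x ^ 2 := by linarith
  rw [hY] at h3
  generalize x ^ 2 = X at *
  have h4 : X - X ^ 2 / 3 ≤ Real.sin x ^ 2 := by nlinarith [pow_nonneg hX0 3]
  have hX1 : X ≤ 1 := by nlinarith
  have h5 : 0 ≤ X - X ^ 2 / 3 := by nlinarith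
  have h6 : (X - X ^ 2 / 3) * (1 + (1 - X + (1 - X) ^ 2 / 4)) ≤
      Real.sin x ^ 2 * (1 + Real.sinh y ^ 2) := by
    apply mul_le_mul h4 (by linarith) (by nlinarith) (sq_nonneg _)
  have hp : 7 / 4 * (253 / 300) ^ 2 ≤ X - X ^ 2 / 3 + (1 - X + (1 - X) ^ 2 / 4) +
      3 / 5 * ((X - X ^ 2 / 3) * (1 + (1 - X + (1 - X) ^ 2 / 4))) := by
    nlinarith [mul_nonneg hX0 (sub_nonneg.2 hX1), mul_nonneg hX0 (sub_nonneg.2 hx),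
      mul_nonneg (mul_nonneg hX0 hX0) (sub_nonneg.2 hx),
      mul_nonneg (mul_nonneg hX0 hX0) (sub_nonneg.2 hX1)]
  linarith

lemma sin_ne_mul_cubicG {w z : ℂ} (hw : ‖w‖ = 1) (hz : z ∈ unitDisk) :
    Complex.sin w ≠ ((Real.sin 1 : ℝ) : ℂ) * cubicG z := by
  intro h
  have hxy := re_sq_add_im_sq_eq_one hw
  have hs := sin_one_bounds.1
  have e1 : Complex.sin w = ((Real.sin w.re * Real.cosh w.im : ℝ) : ℂ) +
      ((Real.cos w.re * Real.sinh w.im : ℝ) : ℂ) * Complex.I := by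
    rw [Complex.sin_eq]; push_cast; ring
  have hre : Real.sin w.re * Real.cosh w.im = Real.sin 1 * (cubicG z).re := by
    have := congrArg Complex.re (e1.symm.trans h)
    rw [Complex.re_ofReal_mul, Complex.add_re, Complex.ofReal_re, Complex.re_ofReal_mul] at this
    simpa using this
  have him : Real.cos w.re * Real.sinh w.im = Real.sin 1 * (cubicG z).im := by
    have := congrArg Complex.im (e1.symm.trans h)
    rw [Complex.im_ofReal_mul, Complex.add_im, Complex.ofReal_im, Complex.im_ofReal_mul] at this
    simpa using this
  have hre2 : Real.sin w.re ^ 2 * (1 + Real.sinh w.im ^ 2) = Real.sin 1 ^ 2 * (cubicG z).re ^ 2 := by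
    rw [← mul_pow, ← hre, mul_pow, Real.cosh_sq]; ring
  have him2 : Real.sin w.re ^ 2 + Real.sinh w.im ^ 2 =
      Real.sin 1 ^ 2 * ((cubicG z).re ^ 2 + (cubicG z).im ^ 2) := by
    rw [mul_add, ← hre2, ← mul_pow (Real.sin 1) (cubicG z).im, ← him, mul_pow, Real.cos_sq']; ring
  have hs2 : 0 < Real.sin 1 ^ 2 := pow_pos (by linarith) 2
  rcases le_total ((17 / 20 : ℝ) ^ 2) (w.re ^ 2) with hx | hx
  · have h1 := sin_one_sq_le hxy hx
    have h2 : (cubicG z).re ^ 2 < 1 := (sq_lt_one_iff_abs_lt_one _).2 (abs_cubicG_re_lt hz)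
    rw [hre2] at h1
    nlinarith
  · have h1 := sin_ellipse_bound hxy hx
    rw [hre2, him2] at h1
    have h2 := cubicG_ellipse hz
    nlinarith

/-- The point d - 1 + iy lies on the unit circle, and e · exp(d - 1 + iy) has real part e^d cos y
and imaginary part e^d sin y. Both sides are of order d², that is y⁴, at d = 0, so the constants
matter; 127/25 is an upper bound for (e - 1)³. -/
lemma exp_mul_cos_le {d y : ℝ} (h0 : 0 ≤ d) (h1 : d ≤ 1) (hy : y ^ 2 = 2 * d - d ^ 2) :
    127 / 25 * (Real.exp d * Real.cos y - 1) ≤ 3 / 10 * Real.exp d ^ 4 * Real.sin y ^ 4 := by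
  have hy1 : y ^ 2 ≤ 1 := by nlinarith [sq_nonneg (1 - d)]
  have hya : |y| ≤ 1 := by rw [← abs_one, ← sq_le_sq]; simpa using hy1
  have hE : Real.exp d ≤ 1 + d + d ^ 2 / 2 + d ^ 3 / 6 + 5 / 96 * d ^ 4 := by
    have := Real.exp_bound' h0 h1 (n := 4) (by norm_num)
    norm_num [Finset.sum_range_succ, Nat.factorial] at this
    linarith
  have hK : Real.cos y ≤ 1 - d + d ^ 2 / 2 + 5 / 24 * d ^ 2 * (1 - d / 2) ^ 2 := by
    have := (abs_le.1 (Real.cos_bound hya)).2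
    have e4 : |y| ^ 4 = (y ^ 2) ^ 2 := by rw [← sq_abs y]; ring
    rw [e4, hy] at this
    nlinarith
  have hK0 : 0 ≤ Real.cos y :=
    (Real.cos_pos_of_le_one hya).le
  have hL : Real.exp d * Real.cos y ≤ (1 + d + d ^ 2 / 2 + d ^ 3 / 6 + 5 / 96 * d ^ 4) *
      (1 - d + d ^ 2 / 2 + 5 / 24 * d ^ 2 * (1 - d / 2) ^ 2) := by gcongr
  have hS := sq_mul_le_sin_sq hy1
  rw [hy] at hS
  have hQ : 1 + 2 * d + 2 * d ^ 2 ≤ Real.exp d ^ 2 := by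
    have := Real.quadratic_le_exp_of_nonneg (x := 2 * d) (by linarith)
    rw [← Real.exp_nat_mul]; push_cast; linarith
  have hT : 2 * d * (1 + 3 / 5 * d) ≤ Real.exp d ^ 2 * Real.sin y ^ 2 := by
    calc 2 * d * (1 + 3 / 5 * d) ≤ (1 + 2 * d + 2 * d ^ 2) *
          ((2 * d - d ^ 2) * (1 - (2 * d - d ^ 2) / 6) ^ 2) := by
          have : 2 * (1 + 3 / 5 * d) ≤ (1 + 2 * d + 2 * d ^ 2) *
            ((2 - d) * (1 - (2 * d - d ^ 2) / 6) ^ 2) := by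
            nlinarith [mul_nonneg h0 (sub_nonneg.2 h1), mul_nonneg (mul_nonneg h0 h0) (sub_nonneg.2 h1),
              mul_nonneg (mul_nonneg (mul_nonneg h0 h0) h0) (sub_nonneg.2 h1),
              mul_nonneg (mul_nonneg (mul_nonneg (mul_nonneg h0 h0) h0) h0) (sub_nonneg.2 h1),
              mul_nonneg (mul_nonneg (mul_nonneg (mul_nonneg (mul_nonneg h0 h0) h0) h0) h0) (sub_nonneg.2 h1),
              mul_nonneg (mul_nonneg (mul_nonneg (mul_nonneg (mul_nonneg (mul_nonneg h0 h0) h0) h0) h0) h0) (sub_nonneg.2 h1)]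
          nlinarith [mul_le_mul_of_nonneg_left this h0]
      _ ≤ _ := by
          apply mul_le_mul hQ hS _ (by positivity)
          apply mul_nonneg _ (sq_nonneg _)
          nlinarith
  have hT2 := pow_le_pow_left₀ (by positivity) hT 2
  have hp : 127 / 25 * ((1 + d + d ^ 2 / 2 + d ^ 3 / 6 + 5 / 96 * d ^ 4) *
      (1 - d + d ^ 2 / 2 + 5 / 24 * d ^ 2 * (1 - d / 2) ^ 2) - 1) ≤
      3 / 10 * (2 * d * (1 + 3 / 5 * d)) ^ 2 := by
    have h2 : d ^ 3 ≤ d := pow_le_of_le_one h0 h1 (by norm_num)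
    have h3 : d ^ 4 ≤ d := pow_le_of_le_one h0 h1 (by norm_num)
    have h4 : d ^ 6 ≤ d := pow_le_of_le_one h0 h1 (by norm_num)
    have h5 : 0 ≤ d ^ 5 := pow_nonneg h0 5
    -- The polynomial inequality has the factor d²; this is the quotient.
    have hq : 0 ≤ 17 / 120 + 89 / 150 * d + 13 / 1500 * d ^ 2 - 127 / 1800 * d ^ 3
        - 1651 / 11520 * d ^ 4 + 127 / 11520 * d ^ 5 - 127 / 9216 * d ^ 6 := by
      nlinarith [sq_nonneg d]
    linear_combination mul_nonneg (sq_nonneg d) hq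
  calc _ ≤ 3 / 10 * (2 * d * (1 + 3 / 5 * d)) ^ 2 := by linarith
    _ ≤ 3 / 10 * (Real.exp d ^ 2 * Real.sin y ^ 2) ^ 2 := by linarith
    _ = _ := by ring

/-- The left quantity is |e^w - 1|² on the right half of the circle. The constant 5/8 just exceeds
(1 - 1/e)² · 25/16, the bound for |cG|². -/
lemma norm_exp_sub_one_sq_ge {x y : ℝ} (hx : 0 ≤ x) (hxy : x ^ 2 + y ^ 2 = 1) :
    5 / 8 ≤ Real.exp x ^ 2 - 2 * Real.exp x * Real.cos y + 1 := by
  have hx1 : x ≤ 1 := by nlinarith [sq_nonneg y]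
  have hy1 : |y| ≤ 1 := (sq_le_one_iff_abs_le_one y).1 (by nlinarith)
  have hE : 1 + x ≤ Real.exp x := by linarith [Real.add_one_le_exp x]
  have hC : Real.cos y ≤ 1 - (1 - x ^ 2) / 2 + 5 / 96 * (1 - x ^ 2) ^ 2 := by
    have := (abs_le.1 (Real.cos_bound hy1)).2
    have e4 : |y| ^ 4 = (1 - x ^ 2) ^ 2 := by
      rw [show 1 - x ^ 2 = y ^ 2 by linarith, ← sq_abs y]; ring
    rw [e4, show y ^ 2 = 1 - x ^ 2 by linarith] at this
    linarith
  have hC1 := Real.cos_le_one y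
  have h3 : (1 + x) ^ 2 - 2 * (1 + x) * Real.cos y ≤
      Real.exp x ^ 2 - 2 * Real.exp x * Real.cos y := by
    nlinarith [mul_nonneg (sub_nonneg.2 hE) (by linarith : 0 ≤ Real.exp x + 1 + x - 2 * Real.cos y)]
  have h4 : (1 + x) * Real.cos y ≤ (1 + x) * (1 - (1 - x ^ 2) / 2 + 5 / 96 * (1 - x ^ 2) ^ 2) := by
    gcongr
  have h5 : x ^ 3 ≤ x := pow_le_of_le_one hx hx1 (by norm_num)
  have h6 : x ^ 5 ≤ x := pow_le_of_le_one hx hx1 (by norm_num)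
  have h7 : x ^ 4 ≤ x ^ 2 := pow_le_pow_of_le_one hx hx1 (by norm_num)
  nlinarith [sq_nonneg x, mul_nonneg hx (sub_nonneg.2 hx1)]

lemma exp_ne_one_add_mul_cubicG {w z : ℂ} (hw : ‖w‖ = 1) (hz : z ∈ unitDisk) :
    Complex.exp w ≠ 1 + ((1 - (Real.exp 1)⁻¹ : ℝ) : ℂ) * cubicG z := by
  intro h
  have hxy := re_sq_add_im_sq_eq_one hw
  have he := Real.exp_one_lt_d9
  have he0 : 0 < Real.exp 1 := Real.exp_pos 1
  set c : ℝ := 1 - (Real.exp 1)⁻¹ with hc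
  have hce : c * Real.exp 1 = Real.exp 1 - 1 := by rw [hc]; field_simp
  have hc0 : 0 < c := by
    have : (1 : ℝ) < Real.exp 1 := by simp
    exact pos_of_mul_pos_left (by linarith : 0 < c * Real.exp 1) he0.le
  have hre : Real.exp w.re * Real.cos w.im = 1 + c * (cubicG z).re := by
    have := congrArg Complex.re h
    rw [Complex.exp_re, Complex.add_re, Complex.re_ofReal_mul] at this
    simpa using this
  have him : Real.exp w.re * Real.sin w.im = c * (cubicG z).im := by
    have := congrArg Complex.im h
    rw [Complex.exp_im, Complex.add_im, Complex.im_ofReal_mul] at this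
    simpa using this
  set x := w.re
  set y := w.im
  have hx1 : x ^ 2 ≤ 1 := by nlinarith [sq_nonneg y]
  have hxa := abs_le.1 ((sq_le_one_iff_abs_le_one x).1 hx1)
  rcases le_or_gt 0 x with hx | hx
  · have hn := normSq_cubicG_lt_const hz
    have hc2 : c < 6323 / 10000 := by nlinarith
    have h1 : (Real.exp x * Real.cos y - 1) ^ 2 + (Real.exp x * Real.sin y) ^ 2 < 5 / 8 := by
      rw [hre, him]
      have hc4 : c ^ 2 ≤ (6323 / 10000) ^ 2 := pow_le_pow_left₀ hc0.le hc2.le 2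
      have h0 := mul_lt_mul_of_pos_left hn (pow_pos hc0 2)
      linarith
    have h2 : Real.exp x ^ 2 - 2 * Real.exp x * Real.cos y + 1 < 5 / 8 := by
      have := Real.sin_sq_add_cos_sq y
      have e : Real.exp x ^ 2 - 2 * Real.exp x * Real.cos y + 1 =
        (Real.exp x * Real.cos y - 1) ^ 2 + (Real.exp x * Real.sin y) ^ 2 := by
        linear_combination (-Real.exp x ^ 2) * this
      rw [e]; exact h1
    linarith [norm_exp_sub_one_sq_ge hx hxy]
  -- On the left half the image of 1 + cG touches the curve exp(e^{it}) at 1/e. After multiplication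
  -- by e, the fourth-order bound for G contradicts `exp_mul_cos_le`.
  · obtain ⟨d, hd⟩ : ∃ d, x = d - 1 := ⟨x + 1, by ring⟩
    have hy : y ^ 2 = 2 * d - d ^ 2 := by rw [hd] at hxy; linarith
    have key := exp_mul_cos_le (d := d) (by linarith) (by linarith) hy
    have hG := cubicG_quartic_bound hz
    have hE : Real.exp d = Real.exp 1 * Real.exp x := by rw [← Real.exp_add, hd]; ring_nf
    have h1 : Real.exp d * Real.cos y - 1 = (Real.exp 1 - 1) * (1 + (cubicG z).re) := by
      rw [hE, mul_assoc, hre]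
      linear_combination (cubicG z).re * hce
    have h2 : Real.exp d * Real.sin y = (Real.exp 1 - 1) * (cubicG z).im := by
      rw [hE, mul_assoc, him]
      linear_combination (cubicG z).im * hce
    rw [mul_assoc, ← mul_pow, h2, h1] at key
    have hk0 : 0 < Real.exp 1 - 1 := by rw [← hce]; positivity
    have hk : Real.exp 1 - 1 ≤ 1719 / 1000 := by linarith
    generalize Real.exp 1 - 1 = k at *
    have hk3 : k ^ 3 ≤ (1719 / 1000) ^ 3 := pow_le_pow_left₀ hk0.le hk 3
    have h5 : 127 / 25 * (1 + (cubicG z).re) ≤ 3 / 10 * (k ^ 3 * (cubicG z).im ^ 4) := by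
      refine le_of_mul_le_mul_left ?_ hk0
      linarith
    have h6 : k ^ 3 * (cubicG z).im ^ 4 ≤ 127 / 25 * (cubicG z).im ^ 4 := by
      have : k ^ 3 ≤ 127 / 25 := by linarith
      gcongr
    linarith

/-! ### Square root and inverse sine -/

/-- The principal square root. -/
noncomputable def sqrtC (s : ℂ) : ℂ := s ^ (2⁻¹ : ℂ)

lemma sqrtC_sq (s : ℂ) : sqrtC s ^ 2 = s := by
  exact Complex.cpow_nat_inv_pow s (n := 2) two_ne_zero

lemma sqrtC_re_pos {s : ℂ} (hs : s ∈ Complex.slitPlane) : 0 < (sqrtC s).re := by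
  rw [sqrtC, Complex.cpow_inv_two_re, Real.sqrt_pos]
  have h1 := Complex.abs_re_le_norm s
  have h2 := neg_abs_le s.re
  rcases Complex.mem_slitPlane_iff.1 hs with h | h
  · have := norm_nonneg s; linarith
  · have h3 : |s.re| < ‖s‖ := by
      rw [Complex.abs_re_lt_norm]; exact h
    linarith

lemma sqrtC_one : sqrtC 1 = 1 := by simp [sqrtC]

lemma sqrtC_sq_of_re_pos {s : ℂ} (hs : 0 < s.re) : sqrtC (s ^ 2) = s :=
  Complex.sq_cpow_two_inv hs

/-- The principal branch of the inverse sine. -/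
noncomputable def arcsine (u : ℂ) : ℂ :=
  -Complex.I * Complex.log (Complex.I * u + sqrtC (1 - u ^ 2))

lemma one_sub_sq_mem_slitPlane {u : ℂ} (hu : |u.re| < 1) : 1 - u ^ 2 ∈ Complex.slitPlane := by
  rw [Complex.mem_slitPlane_iff]
  by_contra! h
  have h1 : (1 - u ^ 2).re = 1 - u.re ^ 2 + u.im ^ 2 := by simp [pow_two]; ring
  rw [h1] at h
  have := (sq_lt_one_iff_abs_lt_one _).2 hu
  nlinarith [sq_nonneg u.im, h.1]

/-- The numbers s = iu + √(1 - u²) and t = -iu + √(1 - u²) satisfy st = 1 and Re(s + t) > 0. A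
nonpositive real s would force t to be negative as well. -/
lemma arcsine_aux_mem_slitPlane {u : ℂ} (hu : |u.re| < 1) :
    Complex.I * u + sqrtC (1 - u ^ 2) ∈ Complex.slitPlane := by
  have hr := sqrtC_re_pos (one_sub_sq_mem_slitPlane hu)
  have hm : (Complex.I * u + sqrtC (1 - u ^ 2)) * (-(Complex.I * u) + sqrtC (1 - u ^ 2)) = 1 := by
    linear_combination sqrtC_sq (1 - u ^ 2) - u ^ 2 * Complex.I_sq
  rw [Complex.mem_slitPlane_iff]
  by_contra! h
  obtain ⟨h1, h2⟩ := h
  set s := Complex.I * u + sqrtC (1 - u ^ 2) with hs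
  set t := -(Complex.I * u) + sqrtC (1 - u ^ 2) with ht
  have hsum : 0 < s.re + t.re := by
    have : s + t = 2 * sqrtC (1 - u ^ 2) := by rw [hs, ht]; ring
    have := congrArg Complex.re this
    simp at this
    linarith
  have h3 := congrArg Complex.re hm
  rw [Complex.mul_re, h2] at h3
  simp at h3
  nlinarith

lemma sin_arcsine {u : ℂ} (hu : |u.re| < 1) : Complex.sin (arcsine u) = u := by
  have hs := Complex.slitPlane_ne_zero (arcsine_aux_mem_slitPlane hu)
  have hm : (Complex.I * u + sqrtC (1 - u ^ 2)) * (-(Complex.I * u) + sqrtC (1 - u ^ 2)) = 1 := by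
    linear_combination sqrtC_sq (1 - u ^ 2) - u ^ 2 * Complex.I_sq
  have e1 : arcsine u * Complex.I = Complex.log (Complex.I * u + sqrtC (1 - u ^ 2)) := by
    rw [arcsine]
    linear_combination (-Complex.log (Complex.I * u + sqrtC (1 - u ^ 2))) * Complex.I_sq
  rw [Complex.sin, neg_mul, e1, Complex.exp_neg, Complex.exp_log hs, 
    inv_eq_of_mul_eq_one_right hm]
  linear_combination -u * Complex.I_sq

lemma arcsine_zero : arcsine 0 = 0 := by simp [arcsine, sqrtC_one]

lemma differentiableAt_arcsine {u : ℂ} (hu : |u.re| < 1) : DifferentiableAt ℂ arcsine u := by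
  have h0 : DifferentiableAt ℂ (fun u : ℂ => 1 - u ^ 2) u := by fun_prop
  have h1 : DifferentiableAt ℂ (fun u : ℂ => sqrtC (1 - u ^ 2)) u :=
    h0.cpow_const (one_sub_sq_mem_slitPlane hu)
  have h2 : DifferentiableAt ℂ (fun u : ℂ => Complex.I * u + sqrtC (1 - u ^ 2)) u :=
    (differentiableAt_fun_id.const_mul Complex.I).add h1
  exact (h2.clog (arcsine_aux_mem_slitPlane hu)).const_mul _

lemma differentiable_cubicG : Differentiable ℂ cubicG := by
  unfold cubicG; fun_prop

lemma cubicG_zero : cubicG 0 = 0 := by simp [cubicG]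

lemma abs_re_mul_cubicG_lt {c : ℝ} (hc0 : 0 < c) (hc1 : c ≤ 1) {z : ℂ} (hz : z ∈ unitDisk) :
    |((c : ℂ) * cubicG z).re| < 1 := by
  rw [Complex.re_ofReal_mul, abs_mul, abs_of_pos hc0]
  have := abs_cubicG_re_lt hz
  nlinarith [abs_nonneg (cubicG z).re]

lemma re_one_add_mul_cubicG_pos {c : ℝ} (hc0 : 0 < c) (hc1 : c ≤ 1) {z : ℂ} (hz : z ∈ unitDisk) :
    0 < (1 + (c : ℂ) * cubicG z).re := by
  have := (abs_lt.1 (abs_re_mul_cubicG_lt hc0 hc1 hz)).1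
  rw [Complex.add_re, Complex.one_re]
  linarith

lemma ne_neg_one_of_mem {ω : ℂ} (hω : ω ∈ unitDisk) : ω ≠ -1 := by
  rintro rfl
  simp at hω

lemma sqrt_two_sq : ((√2 : ℝ) : ℂ) ^ 2 = 2 := by
  exact_mod_cast Real.sq_sqrt (show (0 : ℝ) ≤ 2 by norm_num)

lemma sqrt_two_bounds : (7 / 5 : ℝ) < √2 ∧ √2 < 3 / 2 :=
  ⟨Real.lt_sqrt_of_sq_lt (by norm_num), by rw [Real.sqrt_lt'] <;> norm_num⟩

/-! ### The crescent -/

/-- Here 1 + w² = ((s + 1/s)/2)² for w = (s - 1/s)/2, and Re s > 0 makes (s + 1/s)/2 the principal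
root. -/
lemma phiCrescent_branch {s : ℂ} (hs : 0 < s.re) : phiCrescent ((s - s⁻¹) / 2) = s := by
  have h0 : s ≠ 0 := by rintro rfl; simp at hs
  have e : 1 + ((s - s⁻¹) / 2) ^ 2 = ((s + s⁻¹) / 2) ^ 2 := by field_simp; ring
  have h1 : 0 < ((s + s⁻¹) / 2).re := by
    have : 0 < (s⁻¹).re := by
      rw [Complex.inv_re]; exact div_pos hs (Complex.normSq_pos.2 h0)
    rw [show (s + s⁻¹) / 2 = ((1 / 2 : ℝ) : ℂ) * (s + s⁻¹) by push_cast; ring,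
      Complex.re_ofReal_mul, Complex.add_re]
    linarith
  have h2 := sqrtC_sq_of_re_pos h1
  rw [sqrtC] at h2
  rw [phiCrescent, e, one_div, h2]
  ring

lemma isHolo_phiCrescent : IsHolo phiCrescent := by
  intro z hz
  have h0 : DifferentiableAt ℂ (fun z : ℂ => 1 + z ^ 2) z := by fun_prop
  refine ((h0.cpow_const ?_).add differentiableAt_fun_id).differentiableWithinAt
  have h := re_sq_add_im_sq_lt_one hz
  left
  have : (1 + z ^ 2).re = 1 + z.re ^ 2 - z.im ^ 2 := by simp [pow_two]; ring
  rw [this]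
  nlinarith [sq_nonneg z.re]

lemma exists_schwarz_phiCrescent : ∃ W, IsSchwarz W ∧
    ∀ z ∈ unitDisk, 1 + ((2 - √2 : ℝ) : ℂ) * cubicG z = phiCrescent (W z) := by
  obtain ⟨hq1, hq2⟩ := sqrt_two_bounds
  have hq := Real.sq_sqrt (show (0 : ℝ) ≤ 2 by norm_num)
  set c : ℝ := 2 - √2 with hc
  have hs : ∀ z ∈ unitDisk, 0 < (1 + (c : ℂ) * cubicG z).re := fun z hz =>
    re_one_add_mul_cubicG_pos (by linarith) (by linarith) hz
  have hs0 : ∀ z ∈ unitDisk, 1 + (c : ℂ) * cubicG z ≠ 0 := fun z hz h => by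
    have := hs z hz; rw [h] at this; simp at this
  have hd : Differentiable ℂ fun z => 1 + (c : ℂ) * cubicG z :=
    (differentiable_cubicG.const_mul _).const_add _
  refine ⟨fun z => ((1 + (c : ℂ) * cubicG z) - (1 + (c : ℂ) * cubicG z)⁻¹) / 2,
    isSchwarz_of_norm_ne_one ?_ (by simp [cubicG_zero]) ?_,
    fun z hz => (phiCrescent_branch (hs z hz)).symm⟩
  · intro z hz
    exact (((hd z).sub ((hd z).fun_inv (hs0 z hz))).div_const _).differentiableWithinAt
  · intro z hz hw
    have hz0 := hs0 z hz
    have hg := (abs_lt.1 (abs_cubicG_re_lt hz)).1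
    have hn := normSq_cubicG_lt_const hz
    have hw1 := re_sq_add_im_sq_eq_one hw
    have hp : (1 + (c : ℂ) * cubicG z).re = 1 + c * (cubicG z).re := by simp
    have hi : (1 + (c : ℂ) * cubicG z).im = c * (cubicG z).im := by simp
    have hpos := hs z hz
    set s := 1 + (c : ℂ) * cubicG z
    set w := (s - s⁻¹) / 2 with hwdef
    have e : s * s - 1 = (2 * w) * s := by rw [hwdef]; field_simp
    have e1 := congrArg Complex.re e
    have e2 := congrArg Complex.im e
    simp at e1 e2
    -- |w| = 1 means |s² - 1| = 2|s|, which describes the two circles |s - 1| = √2 and |s + 1| = √2.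
    -- The first is excluded by |G| < 5/4, the second by Re s > √2 - 1.
    have h1 : ((s.re - 1) ^ 2 + s.im ^ 2 - 2) * ((s.re + 1) ^ 2 + s.im ^ 2 - 2) = 0 := by
      have a1 : (s.re * s.re - s.im * s.im - 1) ^ 2 + (s.re * s.im + s.im * s.re) ^ 2 =
          4 * (s.re ^ 2 + s.im ^ 2) := by
        rw [e1, e2]
        linear_combination 4 * (s.re ^ 2 + s.im ^ 2) * hw1
      linear_combination a1
    rw [hp, hi] at h1
    rcases mul_eq_zero.1 h1 with h | h
    · have : c ^ 2 ≤ 1 := by nlinarith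
      nlinarith
    · have : √2 < 2 + c * (cubicG z).re := by nlinarith
      nlinarith [sq_nonneg (c * (cubicG z).im)]

lemma phiCrescent_ne {ω : ℂ} (hω : ω ∈ unitDisk) :
    phiCrescent ω ≠ 1 - ((2 - √2 : ℝ) : ℂ) := by
  intro h
  have hq := sqrt_two_sq
  have h1 := sqrtC_sq (1 + ω ^ 2)
  rw [phiCrescent, one_div] at h
  have h2 : sqrtC (1 + ω ^ 2) = ((√2 : ℝ) : ℂ) - 1 - ω := by
    rw [sqrtC]; push_cast at h; linear_combination h
  rw [h2] at h1
  apply ne_neg_one_of_mem hω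
  have h3 : (((√2 : ℝ) : ℂ) - 1) * (ω + 1) = 0 := by
    linear_combination (-1 / 2) * h1 + (1 / 2) * hq
  have h4 : ((√2 : ℝ) : ℂ) - 1 ≠ 0 := by
    have h5 : (√2 : ℝ) ≠ 1 := ne_of_gt (by linarith [sqrt_two_bounds.1])
    exact sub_ne_zero.2 (by exact_mod_cast h5)
  linear_combination (mul_eq_zero.1 h3).resolve_left h4

/-! ### The cardioid -/

lemma isHolo_phiC : IsHolo phiC := by
  apply Differentiable.differentiableOn
  unfold phiC; fun_prop

lemma exists_schwarz_phiC : ∃ W, IsSchwarz W ∧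
    ∀ z ∈ unitDisk, 1 + ((2 / 3 : ℝ) : ℂ) * cubicG z = phiC (W z) := by
  have hs : ∀ z ∈ unitDisk, 0 < (1 + cubicG z).re := fun z hz => by
    simpa using re_one_add_mul_cubicG_pos one_pos le_rfl hz
  have hd : Differentiable ℂ fun z => 1 + cubicG z := differentiable_cubicG.const_add _
  -- Inverts φ_C(w) = 1/3 + (2/3)(1 + w)².
  refine ⟨fun z => sqrtC (1 + cubicG z) - 1,
    isSchwarz_of_norm_ne_one ?_ (by simp [cubicG_zero, sqrtC_one]) ?_, fun z hz => ?_⟩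
  · intro z hz
    exact (((hd z).cpow_const (Or.inl (hs z hz))).sub_const 1).differentiableWithinAt
  · intro z hz hw
    have hg := (abs_lt.1 (abs_cubicG_re_lt hz)).1
    have hn := normSq_cubicG_lt_const hz
    have hw1 := re_sq_add_im_sq_eq_one hw
    have h2 := sqrtC_sq (1 + cubicG z)
    set w := sqrtC (1 + cubicG z) - 1 with hwdef
    have e : cubicG z = w * (w + 2) := by rw [hwdef]; linear_combination -h2
    have e1 := congrArg Complex.re e
    have e2 := congrArg Complex.im e
    simp at e1 e2
    rw [e1, e2] at hn
    rw [e1] at hg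
    -- On the circle |w(w + 2)|² = 5 + 4 Re w, so |G| < 5/4 makes Re w negative. But Re G = 2x² + 2x
    -- - 1 with x = Re w, which is at most -1 for -1 ≤ x ≤ 0.
    have h3 : 5 + 4 * w.re < 25 / 16 := by
      linear_combination hn + (w.re ^ 2 + w.im ^ 2 + 4 * w.re + 4 + 1) * (-hw1)
    nlinarith
  · have h2 := sqrtC_sq (1 + cubicG z)
    rw [phiC]
    push_cast
    linear_combination (-2 / 3) * h2

lemma phiC_ne {ω : ℂ} (hω : ω ∈ unitDisk) : phiC ω ≠ 1 - ((2 / 3 : ℝ) : ℂ) := by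
  intro h
  rw [phiC] at h
  push_cast at h
  apply ne_neg_one_of_mem hω
  have h3 : (ω + 1) ^ 2 = 0 := by linear_combination (3 / 2) * h
  linear_combination pow_eq_zero_iff two_ne_zero |>.1 h3

/-! ### The limaçon -/

lemma isHolo_phiLim : IsHolo phiLim := by
  apply Differentiable.differentiableOn
  unfold phiLim; fun_prop

lemma exists_schwarz_phiLim : ∃ W, IsSchwarz W ∧
    ∀ z ∈ unitDisk, 1 + ((√2 - 1 / 2 : ℝ) : ℂ) * cubicG z = phiLim (W z) := by
  obtain ⟨hq1, hq2⟩ := sqrt_two_bounds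
  have hq := Real.sq_sqrt (show (0 : ℝ) ≤ 2 by norm_num)
  have hqc := sqrt_two_sq
  set c : ℝ := √2 - 1 / 2 with hc
  have hs : ∀ z ∈ unitDisk, 0 < (2 * (1 + (c : ℂ) * cubicG z)).re := fun z hz => by
    have := re_one_add_mul_cubicG_pos (c := c) (by linarith) (by linarith) hz
    rw [Complex.mul_re]
    simpa using this
  have hd : Differentiable ℂ fun z => 2 * (1 + (c : ℂ) * cubicG z) :=
    ((differentiable_cubicG.const_mul _).const_add _).const_mul _
  -- Inverts φ_lim(w) = (w + √2)²/2.
  refine ⟨fun z => sqrtC (2 * (1 + (c : ℂ) * cubicG z)) - ((√2 : ℝ) : ℂ),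
    isSchwarz_of_norm_ne_one ?_ ?_ ?_, fun z hz => ?_⟩
  · intro z hz
    exact (((hd z).cpow_const (Or.inl (hs z hz))).sub_const _).differentiableWithinAt
  · have := sqrtC_sq_of_re_pos (s := ((√2 : ℝ) : ℂ)) (by simp)
    rw [hqc] at this
    simp [cubicG_zero, this]
  · intro z hz hw
    have hg := (abs_lt.1 (abs_cubicG_re_lt hz)).1
    have hn := normSq_cubicG_lt_const hz
    have hw1 := re_sq_add_im_sq_eq_one hw
    have h2 := sqrtC_sq (2 * (1 + (c : ℂ) * cubicG z))
    set w := sqrtC (2 * (1 + (c : ℂ) * cubicG z)) - ((√2 : ℝ) : ℂ) with hwdef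
    have e : (c : ℂ) * cubicG z = ((√2 : ℝ) : ℂ) * w + ((1 / 2 : ℝ) : ℂ) * (w * w) := by
      rw [hwdef]; push_cast; linear_combination (-1 / 2) * h2 + (1 / 2) * hqc
    have e1 := congrArg Complex.re e
    have e2 := congrArg Complex.im e
    rw [Complex.add_re, Complex.re_ofReal_mul, Complex.re_ofReal_mul, Complex.re_ofReal_mul,
      Complex.mul_re] at e1
    rw [Complex.add_im, Complex.im_ofReal_mul, Complex.im_ofReal_mul, Complex.im_ofReal_mul,
      Complex.mul_im] at e2
    have hc0 : 0 < c := by linarith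
    have hx : w.re ^ 2 ≤ 1 := by nlinarith [sq_nonneg w.im]
    have hx1 := abs_le.1 ((sq_le_one_iff_abs_le_one _).1 hx)
    have h3 : -c < √2 * w.re + (2 * w.re ^ 2 - 1) / 2 := by
      have : √2 * w.re + (2 * w.re ^ 2 - 1) / 2 = c * (cubicG z).re := by
        rw [e1]; linear_combination (1 / 2) * hw1
      nlinarith
    have h4 : 9 / 4 + √2 * w.re < c ^ 2 * (25 / 16) := by
      have : 9 / 4 + √2 * w.re = c ^ 2 * ((cubicG z).re ^ 2 + (cubicG z).im ^ 2) := by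
        rw [mul_add, ← mul_pow, ← mul_pow, e1, e2]
        linear_combination (-(√2 ^ 2) - √2 * w.re - (1 / 4) * (w.re ^ 2 + w.im ^ 2 + 1)) * hw1 - hq
      rw [this]
      exact mul_lt_mul_of_pos_left hn (by positivity)
    have h5 : 0 < (w.re + 1) * (w.re - 1 + √2) := by nlinarith
    have h6 : 0 < w.re - 1 + √2 := pos_of_mul_pos_right h5 (by linarith)
    nlinarith
  · have h2 := sqrtC_sq (2 * (1 + (c : ℂ) * cubicG z))
    rw [phiLim]
    linear_combination (-1 / 2) * h2 + (1 / 2) * hqc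

lemma phiLim_ne {ω : ℂ} (hω : ω ∈ unitDisk) : phiLim ω ≠ 1 - ((√2 - 1 / 2 : ℝ) : ℂ) := by
  intro h
  rw [phiLim] at h
  push_cast at h
  have h3 : (ω + 1) * (ω - 1 + 2 * ((√2 : ℝ) : ℂ)) = 0 := by linear_combination 2 * h
  rcases mul_eq_zero.1 h3 with h4 | h4
  · exact ne_neg_one_of_mem hω (by linear_combination h4)
  · have h5 := congrArg Complex.re h4
    simp at h5
    have h6 := re_sq_add_im_sq_lt_one hω
    nlinarith [sqrt_two_bounds.1, sq_nonneg ω.im]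

/-! ### The exponential -/

lemma one_sub_inv_exp_mem : 0 < 1 - (Real.exp 1)⁻¹ ∧ 1 - (Real.exp 1)⁻¹ ≤ 1 := by
  have h1 : (1 : ℝ) < Real.exp 1 := by simp
  have h2 := inv_lt_one_of_one_lt₀ h1
  have h3 : 0 < (Real.exp 1)⁻¹ := by positivity
  exact ⟨by linarith, by linarith⟩

lemma exists_schwarz_exp : ∃ W, IsSchwarz W ∧
    ∀ z ∈ unitDisk, 1 + ((1 - (Real.exp 1)⁻¹ : ℝ) : ℂ) * cubicG z = Complex.exp (W z) := by
  obtain ⟨h0, h1⟩ := one_sub_inv_exp_mem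
  set c : ℝ := 1 - (Real.exp 1)⁻¹ with hc
  have hs : ∀ z ∈ unitDisk, 1 + (c : ℂ) * cubicG z ∈ Complex.slitPlane := fun z hz =>
    Or.inl (re_one_add_mul_cubicG_pos h0 h1 hz)
  have hd : Differentiable ℂ fun z => 1 + (c : ℂ) * cubicG z :=
    (differentiable_cubicG.const_mul _).const_add _
  have he : ∀ z ∈ unitDisk, Complex.exp (Complex.log (1 + (c : ℂ) * cubicG z)) =
      1 + (c : ℂ) * cubicG z := fun z hz =>
    Complex.exp_log (Complex.slitPlane_ne_zero (hs z hz))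
  exact ⟨fun z => Complex.log (1 + (c : ℂ) * cubicG z), isSchwarz_of_norm_ne_one
    (fun z hz => ((hd z).clog (hs z hz)).differentiableWithinAt) (by simp [cubicG_zero])
    (fun z hz hw => exp_ne_one_add_mul_cubicG hw hz (he z hz)), fun z hz => (he z hz).symm⟩

lemma exp_ne {ω : ℂ} (hω : ω ∈ unitDisk) :
    Complex.exp ω ≠ 1 - ((1 - (Real.exp 1)⁻¹ : ℝ) : ℂ) := by
  intro h
  have h1 : Complex.exp ω = ((Real.exp (-1) : ℝ) : ℂ) := by
    rw [h, Real.exp_neg]; push_cast; ring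
  have h2 := congrArg norm h1
  rw [Complex.norm_exp, Complex.norm_real, Real.norm_eq_abs, abs_of_pos (Real.exp_pos _)] at h2
  have h3 := Real.exp_injective h2
  have h4 := re_sq_add_im_sq_lt_one hω
  rw [h3] at h4
  nlinarith [sq_nonneg ω.im]

/-! ### The sine -/

lemma isHolo_phiS : IsHolo phiS :=
  (Complex.differentiable_sin.const_add 1).differentiableOn

lemma exists_schwarz_phiS : ∃ W, IsSchwarz W ∧
    ∀ z ∈ unitDisk, 1 + ((Real.sin 1 : ℝ) : ℂ) * cubicG z = phiS (W z) := by
  have h0 : 0 < Real.sin 1 := by linarith [sin_one_bounds.1]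
  have hs := fun z hz => abs_re_mul_cubicG_lt (z := z) h0 (Real.sin_le_one 1) hz
  have hd : Differentiable ℂ fun z => ((Real.sin 1 : ℝ) : ℂ) * cubicG z :=
    differentiable_cubicG.const_mul _
  refine ⟨fun z => arcsine (((Real.sin 1 : ℝ) : ℂ) * cubicG z), isSchwarz_of_norm_ne_one
    (fun z hz => ?_) (by rw [cubicG_zero, mul_zero, arcsine_zero])
    (fun z hz hw => sin_ne_mul_cubicG hw hz (sin_arcsine (hs z hz))),
    fun z hz => by rw [phiS, sin_arcsine (hs z hz)]⟩
  exact (DifferentiableAt.comp (g := arcsine) z (differentiableAt_arcsine (hs z hz))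
    (hd z)).differentiableWithinAt

lemma sin_ne_of_mem {ω : ℂ} (hω : ω ∈ unitDisk) : Complex.sin ω ≠ -Complex.sin 1 := by
  intro h
  rw [← Complex.sin_neg, Complex.sin_eq_sin_iff] at h
  have h4 := re_sq_add_im_sq_lt_one hω
  have h5 := abs_lt.1 ((sq_lt_one_iff_abs_lt_one _).1
    (by nlinarith [sq_nonneg ω.im] : ω.re ^ 2 < 1))
  have hpi := Real.pi_gt_three
  obtain ⟨k, hk | hk⟩ := h
  · have h6 := congrArg Complex.re hk
    have h7 : -1 = 2 * (k : ℝ) * Real.pi + ω.re := by simpa using h6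
    have hk0 : ((k : ℤ) : ℝ) < 0 := by nlinarith
    have hk1 : (k : ℝ) ≤ -1 := by exact_mod_cast Int.le_sub_one_of_lt (by exact_mod_cast hk0 : k < 0)
    nlinarith
  · have h6 := congrArg Complex.re hk
    have h7 : -1 = (2 * (k : ℝ) + 1) * Real.pi - ω.re := by simpa using h6
    have hk0 : ((k : ℤ) : ℝ) < 0 := by nlinarith
    have hk1 : (k : ℝ) ≤ -1 := by exact_mod_cast Int.le_sub_one_of_lt (by exact_mod_cast hk0 : k < 0)
    nlinarith

lemma phiS_ne {ω : ℂ} (hω : ω ∈ unitDisk) : phiS ω ≠ 1 - ((Real.sin 1 : ℝ) : ℂ) := by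
  intro h
  rw [phiS] at h
  push_cast at h
  exact sin_ne_of_mem hω (by linear_combination h)

/-! ### The rational function -/

lemma kR_sq : kR ^ 2 = 2 * kR + 1 := by
  rw [kR]; linear_combination sqrt_two_sq

lemma kR_eq_ofReal : kR = ((1 + √2 : ℝ) : ℂ) := by
  rw [kR]; push_cast; ring

lemma kR_ne_zero : kR ≠ 0 := by
  rw [kR_eq_ofReal]
  exact_mod_cast (by positivity : (1 + √2 : ℝ) ≠ 0)

lemma kR_sub_ne_zero {z : ℂ} (hz : z ∈ unitDisk) : kR - z ≠ 0 := by
  intro h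
  have h1 := congrArg Complex.re h
  rw [kR_eq_ofReal, Complex.sub_re, Complex.ofReal_re, Complex.zero_re] at h1
  have h2 := re_sq_add_im_sq_lt_one hz
  nlinarith [sqrt_two_bounds.1, sq_nonneg z.im]

lemma isHolo_phiR : IsHolo phiR := by
  intro z hz
  have h := kR_sub_ne_zero hz
  have : DifferentiableAt ℂ (fun z => 1 + z / kR * ((kR + z) / (kR - z))) z := by
    fun_prop (disch := assumption)
  exact this.differentiableWithinAt

lemma three_sub_mul_kR_sq : ((3 - 2 * √2 : ℝ) : ℂ) * kR ^ 2 = 1 := by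
  rw [kR]; push_cast
  linear_combination (-1 - 2 * ((√2 : ℝ) : ℂ)) * sqrt_two_sq

lemma exists_schwarz_phiR : ∃ W, IsSchwarz W ∧
    ∀ z ∈ unitDisk, 1 + ((3 - 2 * √2 : ℝ) : ℂ) * cubicG z = phiR (W z) := by
  obtain ⟨hq1, hq2⟩ := sqrt_two_bounds
  have hq := Real.sq_sqrt (show (0 : ℝ) ≤ 2 by norm_num)
  have hck := three_sub_mul_kR_sq
  have hk2 := kR_sq
  have hk0 := kR_ne_zero
  have hc6 : ((3 - 2 * √2 : ℝ) : ℂ) + kR ^ 2 = 6 := by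
    rw [kR]; push_cast; linear_combination sqrt_two_sq
  set c : ℝ := 3 - 2 * √2 with hc
  have hc0 : 0 < c := by nlinarith
  have hc1 : c ≤ 1 := by linarith
  have hs1 : ∀ z ∈ unitDisk, 0 < ((c : ℂ) * cubicG z + c).re := fun z hz => by
    rw [Complex.add_re, Complex.re_ofReal_mul, Complex.ofReal_re]
    have := (abs_lt.1 (abs_cubicG_re_lt hz)).1
    nlinarith
  have hs2 : ∀ z ∈ unitDisk, 0 < ((c : ℂ) * cubicG z + kR ^ 2).re := fun z hz => by
    have e : (c : ℂ) * cubicG z + kR ^ 2 = 1 + (c : ℂ) * cubicG z + ((2 + 2 * √2 : ℝ) : ℂ) := by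
      rw [hk2, kR]; push_cast; ring
    rw [e, Complex.add_re, Complex.ofReal_re]
    have := re_one_add_mul_cubicG_pos hc0 hc1 hz
    linarith
  have hd : Differentiable ℂ fun z => (c : ℂ) * cubicG z := differentiable_cubicG.const_mul _
  -- With u = cG, φ₀(w) = 1 + u is the quadratic w² + k(1 + u)w = k²u. Its discriminant is k²(u² +
  -- 6u + 1) = k²(u + c)(u + k²), since ck² = 1 and c + k² = 6. Both factors u + c and u + k² have
  -- positive real part, so the product of their roots is an analytic branch, and it equals 1 at u =
  -- 0.
  set W : ℂ → ℂ := fun z => kR / 2 * (-(1 + (c : ℂ) * cubicG z) +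
    sqrtC ((c : ℂ) * cubicG z + c) * sqrtC ((c : ℂ) * cubicG z + kR ^ 2)) with hW
  have hquad : ∀ z, kR * W z ^ 2 + kR ^ 2 * W z = cubicG z * (kR - W z) := fun z => by
    have h1 := sqrtC_sq ((c : ℂ) * cubicG z + c)
    have h2 := sqrtC_sq ((c : ℂ) * cubicG z + kR ^ 2)
    simp only [hW]
    generalize sqrtC ((c : ℂ) * cubicG z + c) = r1 at *
    generalize sqrtC ((c : ℂ) * cubicG z + kR ^ 2) = r2 at *
    have hR : (r1 * r2) ^ 2 = (1 + (c : ℂ) * cubicG z) ^ 2 + 4 * (c * cubicG z) := by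
      rw [mul_pow, h1, h2]; linear_combination (c : ℂ) * cubicG z * hc6 + hck
    set w := kR / 2 * (-(1 + (c : ℂ) * cubicG z) + r1 * r2) with hw
    have hq : w ^ 2 + kR * (1 + (c : ℂ) * cubicG z) * w = (c : ℂ) * cubicG z * kR ^ 2 := by
      rw [hw]; linear_combination (kR ^ 2 / 4) * hR
    linear_combination kR * hq + cubicG z * (kR - w) * hck
  have hne : ∀ z, kR - W z ≠ 0 := fun z h => by
    have h1 := hquad z
    rw [h, mul_zero, ← sub_eq_zero.1 h] at h1
    exact hk0 (by
      have : kR ^ 3 = 0 := by linear_combination h1 / 2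
      exact pow_eq_zero_iff three_ne_zero |>.1 this)
  refine ⟨W, isSchwarz_of_norm_ne_one ?_ ?_ ?_, fun z hz => ?_⟩
  · intro z hz
    have d1 := ((hd z).add_const (c : ℂ)).cpow_const (c := 2⁻¹) (Or.inl (hs1 z hz))
    have d2 := ((hd z).add_const (kR ^ 2)).cpow_const (c := 2⁻¹) (Or.inl (hs2 z hz))
    exact (((((hd z).const_add 1).fun_neg).add (d1.mul d2)).const_mul _).differentiableWithinAt
  · have h1 : sqrtC (kR ^ 2) = kR := by
      apply sqrtC_sq_of_re_pos
      rw [kR_eq_ofReal, Complex.ofReal_re]; positivity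
    have h2 : sqrtC (c : ℂ) = kR⁻¹ := by
      have h3 : (c : ℂ) = (kR⁻¹) ^ 2 := by field_simp; exact hck
      rw [h3]
      apply sqrtC_sq_of_re_pos
      rw [kR_eq_ofReal, ← Complex.ofReal_inv, Complex.ofReal_re]; positivity
    simp [hW, cubicG_zero, h1, h2, hk0]
  · intro z hz hw
    have hg := (abs_lt.1 (abs_cubicG_re_lt hz)).1
    have hn := normSq_cubicG_lt_const hz
    have hw1 := re_sq_add_im_sq_eq_one hw
    have e := hquad z
    generalize W z = w at *
    rw [kR_eq_ofReal] at e
    have hK2 : (1 + √2) ^ 2 = 2 * (1 + √2) + 1 := by linear_combination hq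
    have hK0 : 12 / 5 < 1 + √2 := by linarith
    have hK1 : 1 + √2 < 5 / 2 := by linarith
    generalize 1 + √2 = k at *
    rw [pow_two, pow_two] at e
    have e1 := congrArg Complex.re e
    have e2 := congrArg Complex.im e
    simp at e1 e2
    have hx : w.re ^ 2 ≤ 1 := by nlinarith [sq_nonneg w.im]
    have hx1 := abs_le.1 ((sq_le_one_iff_abs_le_one _).1 hx)
    have hD : 0 < 2 * k + 2 - 2 * k * w.re := by nlinarith
    have h3 : (cubicG z).re * (2 * k + 2 - 2 * k * w.re) =
        2 * k ^ 2 * (w.re ^ 2 + w.re - 1) := by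
      have a1 : (cubicG z).re * ((k - w.re) ^ 2 + w.im ^ 2) =
          (k * (w.re * w.re - w.im * w.im) + k * k * w.re) * (k - w.re) -
          (k * (w.re * w.im + w.im * w.re) + k * k * w.im) * w.im := by
        linear_combination (-(k - w.re)) * e1 + w.im * e2
      linear_combination a1 + (-(cubicG z).re - 2 * k ^ 2 - k * w.re) * hw1 +
        (-(cubicG z).re + k * w.re) * hK2
    have h4 : ((cubicG z).re ^ 2 + (cubicG z).im ^ 2) * (2 * k + 2 - 2 * k * w.re) =
        k ^ 2 * (2 * k + 2 + 2 * k * w.re) := by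
      have a2 : ((cubicG z).re ^ 2 + (cubicG z).im ^ 2) * ((k - w.re) ^ 2 + w.im ^ 2) =
          (k * (w.re * w.re - w.im * w.im) + k * k * w.re) ^ 2 +
          (k * (w.re * w.im + w.im * w.re) + k * k * w.im) ^ 2 := by
        rw [e1, e2]; ring
      linear_combination a2 + (-((cubicG z).re ^ 2 + (cubicG z).im ^ 2) +
        k ^ 2 * (w.re ^ 2 + w.im ^ 2 + 1 + 2 * k * w.re + k ^ 2)) * hw1 +
        (-((cubicG z).re ^ 2 + (cubicG z).im ^ 2) + k ^ 2) * hK2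
    -- This is Re G > -1. It yields Re w > 0, whence |G|² > k² by `h4`, against |G|² < 25/16.
    have h5 : 0 < (w.re + 1) * ((2 * k + 1) * w.re - k) := by nlinarith
    have h6 : 0 < (2 * k + 1) * w.re - k := pos_of_mul_pos_right h5 (by linarith)
    have h7 : 0 < w.re := by nlinarith
    nlinarith
  · have h1 := hquad z
    have h2 := hne z
    rw [phiR]
    have h3 : W z * (kR + W z) = (c : ℂ) * cubicG z * kR * (kR - W z) := by
      linear_combination (c : ℂ) * kR * h1 - W z * (kR + W z) * hck
    have h4 : W z / kR * ((kR + W z) / (kR - W z)) = (c : ℂ) * cubicG z := by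
      field_simp
      linear_combination h3
    rw [h4]

lemma phiR_ne {ω : ℂ} (hω : ω ∈ unitDisk) : phiR ω ≠ 1 - ((3 - 2 * √2 : ℝ) : ℂ) := by
  intro h
  have hne := kR_sub_ne_zero hω
  have hk0 := kR_ne_zero
  have h1 : ω / kR * ((kR + ω) / (kR - ω)) = -((3 - 2 * √2 : ℝ) : ℂ) := by
    rw [phiR] at h; linear_combination h
  have h2 : ω * (kR + ω) = -((3 - 2 * √2 : ℝ) : ℂ) * (kR * (kR - ω)) := by
    rw [← h1]; field_simp
  have h3 : kR * (ω + 1) ^ 2 = 0 := by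
    linear_combination kR * h2 - (kR - ω) * three_sub_mul_kR_sq - ω * kR_sq
  apply ne_neg_one_of_mem hω
  have h4 := (mul_eq_zero.1 h3).resolve_left hk0
  linear_combination pow_eq_zero_iff two_ne_zero |>.1 h4

/-! ### The nephroid -/

lemma isHolo_phiNe : IsHolo phiNe := by
  apply Differentiable.differentiableOn
  unfold phiNe; fun_prop

lemma exists_schwarz_phiNe : ∃ W, IsSchwarz W ∧
    ∀ z ∈ unitDisk, 1 + ((2 / 3 : ℝ) : ℂ) * cubicG z = phiNe (W z) := by
  have hs := fun z hz => sin_arcsine (u := cubicG z) (abs_cubicG_re_lt (z := z) hz)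
  -- Trigonometric solution of the cubic: with W = 2 sin α the triple-angle formula reads 3W - W³ =
  -- 2 sin 3α.
  have hcub : ∀ z ∈ unitDisk, 2 * cubicG z = 3 * (2 * Complex.sin (arcsine (cubicG z) / 3)) -
      (2 * Complex.sin (arcsine (cubicG z) / 3)) ^ 3 := fun z hz => by
    have h := hs z hz
    rw [show arcsine (cubicG z) = 3 * (arcsine (cubicG z) / 3) by ring,
      Complex.sin_three_mul] at h
    linear_combination -2 * h
  refine ⟨fun z => 2 * Complex.sin (arcsine (cubicG z) / 3), isSchwarz_of_norm_ne_one
    (fun z hz => ?_) (by simp [cubicG_zero, arcsine_zero]) (fun z hz hw => ?_), fun z hz => ?_⟩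
  · have h1 : DifferentiableAt ℂ (fun z => arcsine (cubicG z)) z :=
      DifferentiableAt.comp (g := arcsine) z (differentiableAt_arcsine (abs_cubicG_re_lt hz))
        (differentiable_cubicG z)
    exact ((h1.div_const 3).csin.const_mul 2).differentiableWithinAt
  · have hg := (sq_lt_one_iff_abs_lt_one _).2 (abs_cubicG_re_lt hz)
    have hn := normSq_cubicG_lt_const hz
    have hw1 := re_sq_add_im_sq_eq_one hw
    have e := hcub z hz
    generalize 2 * Complex.sin (arcsine (cubicG z) / 3) = w at *
    rw [show w ^ 3 = w * w * w by ring] at e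
    have e1 := congrArg Complex.re e
    have e2 := congrArg Complex.im e
    simp at e1 e2
    have h3 : (cubicG z).re = 3 * w.re - 2 * w.re ^ 3 := by
      linear_combination (1 / 2) * e1 + (3 / 2) * w.re * hw1
    have h4 : (cubicG z).im = 2 * w.im ^ 3 := by
      linear_combination (1 / 2) * e2 - (3 / 2) * w.im * hw1
    have hx : w.re ^ 2 ≤ 1 := by nlinarith [sq_nonneg w.im]
    rw [h3, h4] at hn
    rw [h3] at hg
    have h5 : 4 - 3 * w.re ^ 2 < 25 / 16 := by
      have hi : w.im ^ 2 = 1 - w.re ^ 2 := by linarith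
      have hi6 : (2 * w.im ^ 3) ^ 2 = 4 * (1 - w.re ^ 2) ^ 3 := by rw [← hi]; ring
      rw [hi6] at hn
      linear_combination hn
    -- The modulus bound `h5` gives A = (Re w)² > 13/16, and on (13/16, 1] the value A(3 - 2A)² =
    -- (Re G)² is at least 1.
    have h6 : (3 * w.re - 2 * w.re ^ 3) ^ 2 = w.re ^ 2 * (3 - 2 * w.re ^ 2) ^ 2 := by ring
    rw [h6] at hg
    generalize w.re ^ 2 = A at *
    nlinarith [mul_nonneg (sq_nonneg (A - 1)) (by linarith : 0 ≤ 4 * A - 1)]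
  · have h := hcub z hz
    rw [phiNe]
    push_cast
    linear_combination (1 / 3) * h

lemma phiNe_ne {ω : ℂ} (hω : ω ∈ unitDisk) : phiNe ω ≠ 1 - ((2 / 3 : ℝ) : ℂ) := by
  intro h
  rw [phiNe] at h
  push_cast at h
  have h3 : (ω + 1) ^ 2 * (ω - 2) = 0 := by linear_combination -3 * h
  rcases mul_eq_zero.1 h3 with h4 | h4
  · apply ne_neg_one_of_mem hω
    linear_combination pow_eq_zero_iff two_ne_zero |>.1 h4
  · have h5 := re_sq_add_im_sq_lt_one hω
    rw [sub_eq_zero.1 h4] at h5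
    norm_num at h5

/-! ### Jack's lemma -/

open Filter Topology in
lemma hasDerivAt_nonpos_of_le_right {g : ℝ → ℝ} {d : ℝ} (hg : HasDerivAt g d 0)
    (h : ∀ t, 0 < t → g t ≤ g 0) : d ≤ 0 := by
  refine le_of_tendsto hg.tendsto_slope_zero_right ?_
  filter_upwards [self_mem_nhdsWithin] with t ht
  have ht' : 0 < t := ht
  have := h t ht'
  rw [zero_add, smul_eq_mul]
  exact mul_nonpos_of_nonneg_of_nonpos (inv_nonneg.2 ht'.le) (by linarith)

/-- Jack's lemma. -/
lemma jack {v : ℂ → ℂ} (hv : IsHolo v) (h0 : v 0 = 0) {z₀ : ℂ} (hz₀ : z₀ ∈ unitDisk)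
    (h1 : ‖v z₀‖ = 1) (hlt : ∀ z, ‖z‖ < ‖z₀‖ → ‖v z‖ < 1) :
    ∃ m : ℝ, 1 ≤ m ∧ z₀ * deriv v z₀ = m * v z₀ := by
  have hz0 : z₀ ≠ 0 := by rintro rfl; simp [h0] at h1
  have hr : 0 < ‖z₀‖ := norm_pos_iff.2 hz0
  have hv0 : v z₀ ≠ 0 := by rw [← norm_pos_iff, h1]; exact one_pos
  have hsub : ball (0 : ℂ) ‖z₀‖ ⊆ unitDisk := ball_subset_ball (mem_ball_zero_iff.1 hz₀).le
  have hschwarz : ∀ z, ‖z‖ < ‖z₀‖ → ‖v z‖ ≤ ‖z‖ / ‖z₀‖ := fun z hz => by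
    have := Complex.dist_le_div_mul_dist_of_mapsTo_ball (c := 0) (R₁ := ‖z₀‖) (R₂ := 1) (f := v)
      (hv.mono hsub) (fun y hy => by
        rw [h0, mem_closedBall_zero_iff]; exact (hlt y (mem_ball_zero_iff.1 hy)).le)
      (mem_ball_zero_iff.2 hz)
    rw [h0, dist_zero_right, dist_zero_right] at this
    rw [div_eq_inv_mul, ← one_div]; exact this
  have hdv : HasDerivAt v (deriv v z₀) z₀ :=
    (hv.differentiableAt (isOpen_ball.mem_nhds hz₀)).hasDerivAt
  set q : ℂ := z₀ * deriv v z₀ / v z₀ - 1 with hq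
  -- Approach z₀ from inside the disk |z| < |z₀| along z₀e^{xs}, x > 0, with Re s = -1. The Schwarz
  -- lemma bounds v(z₀e^{xs})e^{-xs}/v(z₀) by 1 in modulus; its value at x = 0 is 1, so its
  -- derivative qs there has nonpositive real part. The freedom in t makes q real, and t = 0 gives q
  -- ≥ 0.
  have key : ∀ t : ℝ, (q * (-1 + t * Complex.I)).re ≤ 0 := fun t => by
    set s : ℂ := -1 + t * Complex.I with hs
    have hsre : s.re = -1 := by simp [hs]
    have hF : HasDerivAt (fun x : ℂ => v (z₀ * Complex.exp (x * s)) / v z₀ * Complex.exp (-(x * s)))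
        (q * s) 0 := by
      have d1 : HasDerivAt (fun x : ℂ => x * s) s 0 := by
        simpa using (hasDerivAt_id (0 : ℂ)).mul_const s
      have d2 : HasDerivAt (fun x : ℂ => z₀ * Complex.exp (x * s)) (z₀ * s) 0 := by
        simpa using (d1.cexp).const_mul z₀
      have d3 : HasDerivAt (fun x : ℂ => v (z₀ * Complex.exp (x * s))) (deriv v z₀ * (z₀ * s)) 0 := by
        refine HasDerivAt.comp (h₂ := v) (0 : ℂ) ?_ d2
        simpa using hdv
      have d4 := (d3.div_const (v z₀)).mul d1.fun_neg.cexp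
      have e : q * s = deriv v z₀ * (z₀ * s) / v z₀ * Complex.exp (-(0 * s)) +
          v (z₀ * Complex.exp (0 * s)) / v z₀ * (Complex.exp (-(0 * s)) * -s) := by
        simp only [hq, zero_mul, neg_zero, Complex.exp_zero, mul_one, one_mul]
        field_simp
        ring
      rw [e]
      exact d4
    have hFr := HasDerivAt.real_of_complex (z := (0 : ℝ)) (by simpa using hF)
    refine hasDerivAt_nonpos_of_le_right hFr fun x hx => ?_
    have hexp : ‖Complex.exp (x * s)‖ = Real.exp (-x) := by
      rw [Complex.norm_exp, Complex.re_ofReal_mul, hsre]; ring_nf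
    have hexp' : ‖Complex.exp (-(x * s))‖ = Real.exp x := by
      rw [Complex.norm_exp, Complex.neg_re, Complex.re_ofReal_mul, hsre]; ring_nf
    have hnorm : ‖z₀ * Complex.exp (x * s)‖ = ‖z₀‖ * Real.exp (-x) := by rw [norm_mul, hexp]
    have hlt' : ‖z₀ * Complex.exp (x * s)‖ < ‖z₀‖ := by
      rw [hnorm]
      exact mul_lt_of_lt_one_right hr (by simpa using hx)
    have hb := hschwarz _ hlt'
    rw [hnorm, mul_div_cancel_left₀ _ hr.ne'] at hb
    have h2 : ‖v (z₀ * Complex.exp (x * s)) / v z₀ * Complex.exp (-(x * s))‖ ≤ 1 := by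
      rw [norm_mul, norm_div, h1, div_one, hexp']
      calc _ ≤ Real.exp (-x) * Real.exp x := by gcongr
        _ = 1 := by rw [← Real.exp_add]; simp
    have h3 := (Complex.re_le_norm _).trans h2
    simpa [hv0] using h3
  have hre := key 0
  have him : q.im = 0 := by
    by_contra hne
    -- For this t the real part of q(-1 + it) equals 1.
    have := key ((-q.re - 1) / q.im)
    simp at this
    field_simp at this
    linarith
  simp at hre
  refine ⟨1 + q.re, by linarith, ?_⟩
  have : (q.re : ℂ) = q := by
    apply Complex.ext <;> simp [him]
  push_cast
  rw [this, hq]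
  field_simp
  ring

/-! ### Starlikeness of the nephroid -/

/-- This bound and the next concern H(z) = 3z - z³ with z = a + bi. On the unit circle both are
equalities, |H|² = 4(1 + 3b²) and (Im H)² = 16b⁶, which together parametrize the nephroid. -/
lemma nephroid_normSq_lt {a b : ℝ} (h : a ^ 2 + b ^ 2 < 1) :
    (3 * a - a ^ 3 + 3 * a * b ^ 2) ^ 2 + (3 * b - 3 * a ^ 2 * b + b ^ 3) ^ 2 <
      4 * (1 + 3 * b ^ 2) := by
  have e : (3 * a - a ^ 3 + 3 * a * b ^ 2) ^ 2 + (3 * b - 3 * a ^ 2 * b + b ^ 3) ^ 2 =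
    (a ^ 2 + b ^ 2) * (9 - 6 * (a ^ 2 - b ^ 2) + (a ^ 2 + b ^ 2) ^ 2) := by ring
  have hA := sq_nonneg a
  have hB := sq_nonneg b
  rw [e]
  generalize a ^ 2 = A at *
  generalize b ^ 2 = B at *
  have hS0 : 0 ≤ A + B := by linarith
  have hS : 0 < 1 - (A + B) := by linarith
  nlinarith [mul_pos hS hS, mul_nonneg hB hS.le, mul_pos (mul_pos hS hS) (by linarith : 0 < 4 - (A + B))]

lemma nephroid_im_sq_ge {a b : ℝ} (h : a ^ 2 + b ^ 2 < 1) :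
    16 * (b ^ 2) ^ 3 ≤ (3 * b - 3 * a ^ 2 * b + b ^ 3) ^ 2 := by
  have e : (3 * b - 3 * a ^ 2 * b + b ^ 3) ^ 2 = b ^ 2 * (3 - 3 * a ^ 2 + b ^ 2) ^ 2 := by ring
  have hB := sq_nonneg b
  have h2 := pow_le_pow_left₀ (by linarith : 0 ≤ 4 * b ^ 2)
    (by linarith : 4 * b ^ 2 ≤ 3 - 3 * a ^ 2 + b ^ 2) 2
  rw [e]
  linarith [mul_le_mul_of_nonneg_left h2 hB]

/-- The cubic `z - z ^ 3 / 3` is starlike. -/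
lemma starlike_nephroid {v w : ℂ} (hv : ‖v‖ = 1) (hw : ‖w‖ < 1) {m : ℝ} (hm : 1 ≤ m) :
    w - w ^ 3 / 3 ≠ m * (v - v ^ 3 / 3) := by
  intro h
  have hv1 := re_sq_add_im_sq_eq_one hv
  have hw1 := re_sq_add_im_sq_lt_one (mem_ball_zero_iff.2 hw)
  have e : 3 * w - w * w * w = m * (3 * v - v * v * v) := by linear_combination 3 * h
  have e1 := congrArg Complex.re e
  have e2 := congrArg Complex.im e
  rw [Complex.re_ofReal_mul] at e1
  rw [Complex.im_ofReal_mul] at e2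
  simp at e1 e2
  have f1 : 3 * w.re - w.re ^ 3 + 3 * w.re * w.im ^ 2 = m * (6 * v.re - 4 * v.re ^ 3) := by
    linear_combination e1 + m * 3 * v.re * hv1
  have f2 : 3 * w.im - 3 * w.re ^ 2 * w.im + w.im ^ 3 = m * (4 * v.im ^ 3) := by
    linear_combination e2 - m * 3 * v.im * hv1
  have g1 := nephroid_normSq_lt hw1
  have g2 := nephroid_im_sq_ge hw1
  rw [f1, f2] at g1
  rw [f2] at g2
  have hm2 : 1 ≤ m ^ 2 := one_le_pow₀ hm
  -- Comparing imaginary parts, with m² ≤ m⁶, gives (Im w)² ≤ m²(Im v)². Inserted into the modulus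
  -- bound this yields 4m²(1 + 3(Im v)²) < 4 + 12m²(Im v)², so m < 1.
  have g3 : (w.im ^ 2) ^ 3 ≤ (m ^ 2 * v.im ^ 2) ^ 3 := by
    have : m ^ 2 ≤ (m ^ 2) ^ 3 := le_self_pow₀ hm2 (by norm_num)
    have h6 : 0 ≤ v.im ^ 6 := by positivity
    nlinarith
  have g4 : w.im ^ 2 ≤ m ^ 2 * v.im ^ 2 := le_of_pow_le_pow_left₀ three_ne_zero (by positivity) g3
  have g5 : (m * (6 * v.re - 4 * v.re ^ 3)) ^ 2 + (m * (4 * v.im ^ 3)) ^ 2 =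
      4 * (m ^ 2 * (1 + 3 * v.im ^ 2)) := by
    have hx : v.re ^ 2 = 1 - v.im ^ 2 := by linarith
    have : (m * (6 * v.re - 4 * v.re ^ 3)) ^ 2 = m ^ 2 * (v.re ^ 2 * (6 - 4 * v.re ^ 2) ^ 2) := by
      ring
    rw [this, hx]
    ring
  linarith

/-! ### Subordination to the best dominant -/

lemma IsSchwarz.norm_le {w : ℂ → ℂ} (hw : IsSchwarz w) {z : ℂ} (hz : z ∈ unitDisk) :
    ‖w z‖ ≤ ‖z‖ :=
  Complex.norm_le_norm_of_mapsTo_ball hw.1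
    (fun y hy => mem_closedBall_zero_iff.2 (hw.2.2 y hy).le) hw.2.1 (mem_ball_zero_iff.1 hz)

lemma IsSchwarz.comp {v w : ℂ → ℂ} (hv : IsSchwarz v) (hw : IsSchwarz w) :
    IsSchwarz (fun z => v (w z)) :=
  ⟨hv.1.comp hw.1 fun z hz => mem_ball_zero_iff.2 (hw.2.2 z hz), by simp [hw.2.1, hv.2.1],
    fun z hz => hv.2.2 _ (mem_ball_zero_iff.2 (hw.2.2 z hz))⟩

open Filter Topology in
-- Since |w(z)| ≤ |z|, the equation gives |P'(z)| ≤ 1 + |z|²/3, and radial integration gives 1 +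
-- 1/9. The point is that (√3/2)(10/9) < 1, which keeps (√3/2)P in the strip where `arcsine` is
-- analytic.
lemma norm_le_of_mul_deriv_eq {P w : ℂ → ℂ} (hP : IsHolo P) (hP0 : P 0 = 0) (hw : IsSchwarz w)
    {l : ℝ} (hl0 : 0 < l) (hl1 : l ≤ 1)
    (h : ∀ z ∈ unitDisk, z * deriv P z = l * (w z - w z ^ 3 / 3)) {z : ℂ} (hz : z ∈ unitDisk) :
    ‖P z‖ ≤ 10 / 9 := by
  have hb0 : ∀ u ∈ unitDisk, u ≠ 0 → ‖deriv P u‖ ≤ 1 + ‖u‖ ^ 2 / 3 := fun u hu hu0 => by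
    have hu1 : 0 < ‖u‖ := norm_pos_iff.2 hu0
    have h1 : ‖u‖ * ‖deriv P u‖ ≤ ‖u‖ * (1 + ‖u‖ ^ 2 / 3) := by
      rw [← norm_mul, h u hu, norm_mul, Complex.norm_real, Real.norm_eq_abs, abs_of_pos hl0]
      have h2 := hw.norm_le hu
      calc l * ‖w u - w u ^ 3 / 3‖ ≤ 1 * (‖w u‖ + ‖w u ^ 3 / 3‖) := by
            gcongr; exact norm_sub_le _ _
        _ = ‖w u‖ + ‖w u‖ ^ 3 / 3 := by simp
        _ ≤ ‖u‖ + ‖u‖ ^ 3 / 3 := by gcongr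
        _ = _ := by ring
    exact le_of_mul_le_mul_left h1 hu1
  have hdP : IsHolo (deriv P) := DifferentiableOn.deriv hP isOpen_ball
  have hb : ∀ u ∈ unitDisk, ‖deriv P u‖ ≤ 1 + ‖u‖ ^ 2 / 3 := fun u hu => by
    rcases eq_or_ne u 0 with rfl | hu0
    · have hc : ContinuousAt (fun u => ‖deriv P u‖ - (1 + ‖u‖ ^ 2 / 3)) 0 := by
        have := (hdP.differentiableAt (isOpen_ball.mem_nhds hu)).continuousAt
        fun_prop
      have hle : ‖deriv P 0‖ - (1 + ‖(0 : ℂ)‖ ^ 2 / 3) ≤ 0 := by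
        refine le_of_tendsto (hc.tendsto.mono_left (nhdsWithin_le_nhds (s := {0}ᶜ))) ?_
        filter_upwards [self_mem_nhdsWithin,
          nhdsWithin_le_nhds (isOpen_ball.mem_nhds hu)] with y hy0 hy
        linarith [hb0 y hy hy0]
      linarith
    · exact hb0 u hu hu0
  have hz1 : ‖z‖ < 1 := mem_ball_zero_iff.1 hz
  have hmem : ∀ t ∈ Icc (0 : ℝ) 1, (t : ℂ) * z ∈ unitDisk := fun t ht => by
    rw [mem_ball_zero_iff, norm_mul, Complex.norm_real, Real.norm_eq_abs, abs_of_nonneg ht.1]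
    nlinarith [norm_nonneg z, ht.2]
  have hder : ∀ t ∈ Icc (0 : ℝ) 1,
      HasDerivAt (fun t : ℝ => P (t * z)) (deriv P (t * z) * z) t := fun t ht => by
    have d1 : HasDerivAt (fun x : ℂ => x * z) z (t : ℂ) := by
      simpa using (hasDerivAt_id (t : ℂ)).mul_const z
    have d2 := (hP.differentiableAt (isOpen_ball.mem_nhds (hmem t ht))).hasDerivAt
    exact (HasDerivAt.comp (h₂ := P) (t : ℂ) d2 d1).comp_ofReal
  have := image_norm_le_of_norm_deriv_right_le_deriv_boundary (a := (0 : ℝ)) (b := 1)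
    (f := fun t : ℝ => P (t * z)) (f' := fun t : ℝ => deriv P (t * z) * z)
    (B := fun t => t + t ^ 3 / 9) (B' := fun t => 1 + t ^ 2 / 3)
    (fun t ht => (hder t ht).continuousAt.continuousWithinAt)
    (fun t ht => (hder t (Ico_subset_Icc_self ht)).hasDerivWithinAt) (by simp [hP0])
    (fun t => by
      have := (hasDerivAt_id' t).fun_add ((hasDerivAt_pow 3 t).div_const 9)
      exact this.congr_deriv (by push_cast; ring))
    (fun t ht => by
      have h1 := hb _ (hmem t (Ico_subset_Icc_self ht))
      rw [norm_mul, Complex.norm_real, Real.norm_eq_abs, abs_of_nonneg ht.1] at h1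
      rw [norm_mul]
      have h3 : t * ‖z‖ ≤ t := mul_le_of_le_one_right ht.1 hz1.le
      have h4 : 0 ≤ t * ‖z‖ := mul_nonneg ht.1 (norm_nonneg z)
      calc _ ≤ (1 + (t * ‖z‖) ^ 2 / 3) * 1 := by gcongr
        _ ≤ 1 + t ^ 2 / 3 := by rw [mul_one]; gcongr)
    (right_mem_Icc.2 zero_le_one)
  norm_num at this
  exact this

/-- If `z P' = l h(w)` with `h z = z - z ^ 3 / 3` and `l ≤ 1`, then `P` is subordinate to the
integral `z - z ^ 3 / 9` of `h z / z`. -/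
lemma exists_schwarz_of_mul_deriv_eq {P w : ℂ → ℂ} (hP : IsHolo P) (hP0 : P 0 = 0)
    (hw : IsSchwarz w) {l : ℝ} (hl0 : 0 < l) (hl1 : l ≤ 1)
    (h : ∀ z ∈ unitDisk, z * deriv P z = l * (w z - w z ^ 3 / 3)) :
    ∃ v, IsSchwarz v ∧ ∀ z ∈ unitDisk, P z = v z - v z ^ 3 / 9 := by
  set r : ℂ := ((√3 : ℝ) : ℂ) with hr
  have hr2 : r ^ 2 = 3 := by
    rw [hr]; exact_mod_cast Real.sq_sqrt (show (0 : ℝ) ≤ 3 by norm_num)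
  have hre : ∀ z ∈ unitDisk, |(((√3 / 2 : ℝ) : ℂ) * P z).re| < 1 := fun z hz => by
    have h1 := norm_le_of_mul_deriv_eq hP hP0 hw hl0 hl1 h hz
    have h2 := (Complex.abs_re_le_norm (P z)).trans h1
    have h3 : √3 < 7 / 4 := by rw [Real.sqrt_lt'] <;> norm_num
    rw [Complex.re_ofReal_mul, abs_mul, abs_of_nonneg (by positivity)]
    have : 0 ≤ √3 := Real.sqrt_nonneg 3
    nlinarith [abs_nonneg (P z).re]
  set α : ℂ → ℂ := fun z => arcsine (((√3 / 2 : ℝ) : ℂ) * P z) / 3 with hα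
  -- With v = 2√3 sin α the triple-angle formula turns v - v³/9 into (2/√3) sin 3α.
  set v : ℂ → ℂ := fun z => 2 * r * Complex.sin (α z) with hv
  have hvP : ∀ z ∈ unitDisk, P z = v z - v z ^ 3 / 9 := fun z hz => by
    have h1 := sin_arcsine (hre z hz)
    rw [show arcsine (((√3 / 2 : ℝ) : ℂ) * P z) = 3 * α z by simp only [hα]; ring,
      Complex.sin_three_mul] at h1
    push_cast at h1
    rw [← hr] at h1
    simp only [hv]
    generalize Complex.sin (α z) = S at *
    linear_combination (-2 / 3) * r * h1 - ((1 / 3) * P z - (8 / 9) * r * S ^ 3) * hr2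
  have hvd : IsHolo v := fun z hz => by
    have h1 := hP.differentiableAt (isOpen_ball.mem_nhds hz)
    have h2 : DifferentiableAt ℂ (fun z => arcsine (((√3 / 2 : ℝ) : ℂ) * P z)) z :=
      DifferentiableAt.comp (g := arcsine) z (differentiableAt_arcsine (hre z hz))
        (h1.const_mul _)
    exact ((h2.div_const 3).csin.const_mul _).differentiableWithinAt
  have hv0 : v 0 = 0 := by simp [hv, hα, hP0, arcsine_zero]
  refine ⟨v, isSchwarz_of_norm_ne_one hvd hv0 fun z₁ hz₁ hvz₁ => ?_, hvP⟩
  have hsub : closedBall (0 : ℂ) ‖z₁‖ ⊆ unitDisk := closedBall_subset_ball (mem_ball_zero_iff.1 hz₁)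
  have hS : IsCompact (closedBall (0 : ℂ) ‖z₁‖ ∩ (fun z => ‖v z‖) ⁻¹' {1}) :=
    (isCompact_closedBall _ _).of_isClosed_subset
      ((hvd.continuousOn.mono hsub).norm.preimage_isClosed_of_isClosed isClosed_closedBall
        isClosed_singleton) inter_subset_left
  -- A point of least modulus with |v| = 1, so that |v| < 1 on |z| < |z₀| as Jack's lemma requires.
  obtain ⟨z₀, ⟨hz₀, hvz₀⟩, hmin⟩ := hS.exists_isMinOn ⟨z₁, by simp, hvz₁⟩ continuous_norm.continuousOn
  have hz₀D := hsub hz₀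
  have hz₀1 := mem_closedBall_zero_iff.1 hz₀
  have hlt : ∀ z, ‖z‖ < ‖z₀‖ → ‖v z‖ < 1 := fun z hz => by
    refine norm_lt_one_on_ball (r := ‖z₀‖) (hvd.continuousOn.mono ?_) hv0 (fun y hy hy1 => ?_)
      (mem_ball_zero_iff.2 hz)
    · exact (ball_subset_ball hz₀1).trans (ball_subset_closedBall.trans hsub)
    · have hy' := mem_ball_zero_iff.1 hy
      have : ‖z₀‖ ≤ ‖y‖ := hmin ⟨mem_closedBall_zero_iff.2 (by linarith), hy1⟩
      linarith
  obtain ⟨m, hm, hmv⟩ := jack hvd hv0 hz₀D hvz₀ hlt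
  have hder : deriv P z₀ = deriv v z₀ - v z₀ ^ 2 * deriv v z₀ / 3 := by
    have d1 := (hvd.differentiableAt (isOpen_ball.mem_nhds hz₀D)).hasDerivAt
    have d2 := d1.fun_sub ((d1.fun_pow 3).div_const 9)
    have e : P =ᶠ[nhds z₀] fun z => v z - v z ^ 3 / 9 := by
      filter_upwards [isOpen_ball.mem_nhds hz₀D] with z hz using hvP z hz
    rw [e.deriv_eq, d2.deriv]
    norm_num
    ring
  have h1 := h z₀ hz₀D
  -- At z₀ the equation reads l h(w) = (1 - v²/3) z₀v' = m h(v) with h(z) = z - z³/3.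
  refine starlike_nephroid hvz₀ (hw.2.2 z₀ hz₀D) (m := m / l) ?_ ?_
  · rw [one_le_div hl0]; linarith
  · have hl : (l : ℂ) ≠ 0 := by exact_mod_cast hl0.ne'
    rw [hder] at h1
    push_cast
    field_simp
    linear_combination -3 * h1 + (3 - v z₀ ^ 2) * hmv

/-- The best dominant. -/
lemma exists_schwarz_of_subordinate {p : ℂ → ℂ} (hp : IsHolo p) (hp0 : p 0 = 1) {β c : ℝ}
    (hc : 0 < c) (hβ : 8 / (9 * c) ≤ β)
    (h : Subordinate (fun z => 1 + (β : ℂ) * (z * deriv p z)) phiNe) :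
    ∃ v, IsSchwarz v ∧ ∀ z ∈ unitDisk, p z = 1 + (c : ℂ) * cubicG (v z) := by
  obtain ⟨-, -, w, hw, hwz⟩ := h
  set b : ℝ := 8 / (9 * c) with hb
  have hb0 : 0 < b := by positivity
  have hβ0 : 0 < β := by linarith
  have hbC : (b : ℂ) ≠ 0 := by exact_mod_cast hb0.ne'
  have hβC : (β : ℂ) ≠ 0 := by exact_mod_cast hβ0.ne'
  have hcC : (c : ℂ) ≠ 0 := by exact_mod_cast hc.ne'
  -- The scaling by b = 8/(9c) makes b · cG(v) = v - v³/9, and the factor l = b/β is at most 1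
  -- precisely because β ≥ b.
  obtain ⟨v, hv, hvz⟩ := exists_schwarz_of_mul_deriv_eq (P := fun z => (b : ℂ) * (p z - 1)) (w := w)
    ((hp.sub_const 1).const_mul _) (by simp [hp0]) hw (l := b / β) (by positivity)
    (by rw [div_le_one hβ0]; exact hβ) fun z hz => by
      have h1 := hwz z hz
      have hpd := (hp.differentiableAt (isOpen_ball.mem_nhds hz)).hasDerivAt
      rw [((hpd.sub_const 1).const_mul (b : ℂ)).deriv]
      rw [phiNe] at h1
      push_cast
      field_simp
      linear_combination 3 * h1
  refine ⟨v, hv, fun z hz => ?_⟩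
  have h1 := hvz z hz
  have h2 : (b : ℂ) * c * 9 = 8 := by rw [hb]; push_cast; field_simp
  rw [cubicG]
  refine mul_left_cancel₀ hbC ?_
  linear_combination h1 - (9 * v z - v z ^ 3) / 72 * h2

/-! ### From f to p = zf'/f -/

lemma isHolo_deriv {f : ℂ → ℂ} (hf : IsHolo f) : IsHolo (deriv f) :=
  DifferentiableOn.deriv hf isOpen_ball

lemma IsHolo.differentiableAt_of_mem {f : ℂ → ℂ} (hf : IsHolo f) {z : ℂ} (hz : z ∈ unitDisk) :
    DifferentiableAt ℂ f z :=
  DifferentiableOn.differentiableAt hf (isOpen_ball.mem_nhds hz)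

lemma IsHolo.analyticOnNhd {f : ℂ → ℂ} (hf : IsHolo f) : AnalyticOnNhd ℂ f unitDisk :=
  DifferentiableOn.analyticOnNhd hf isOpen_ball

open Filter Topology in
lemma IsHolo.eventually_ne_zero {f : ℂ → ℂ} (hf : IsHolo f) {a : ℂ} (ha : a ∈ unitDisk)
    (hfa : f a ≠ 0) {z : ℂ} (hz : z ∈ unitDisk) : ∀ᶠ y in 𝓝[≠] z, f y ≠ 0 := by
  rcases (hf.analyticOnNhd z hz).eventually_eq_zero_or_eventually_ne_zero with h | h
  · exact absurd (hf.analyticOnNhd.eqOn_zero_of_preconnected_of_eventuallyEq_zero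
      (convex_ball (0 : ℂ) 1).isPreconnected hz h ha) hfa
  · exact h

lemma mul_deriv_logQuot {f : ℂ → ℂ} (hf : IsHolo f) {z : ℂ} (hz : z ∈ unitDisk) (h0 : f z ≠ 0)
    (h1 : deriv f z ≠ 0) : z * deriv (fun z => z * deriv f z / f z) z =
      (z * deriv f z / f z) * (1 - z * deriv f z / f z + z * deriv (deriv f) z / deriv f z) := by
  have d1 := (hf.differentiableAt_of_mem hz).hasDerivAt
  have d2 := ((isHolo_deriv hf).differentiableAt_of_mem hz).hasDerivAt
  rw [(((hasDerivAt_id' z).fun_mul d2).fun_div d1 h0).deriv]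
  field_simp
  ring

open Filter Topology in
/-- A function in `ClassA` satisfying the starlikeness hypothesis has no zero besides the origin. -/
lemma ne_zero_of_starHypothesis {β : ℝ} (hβ : 0 < β) {f : ℂ → ℂ} (hf : f ∈ ClassA)
    (h : StarHypothesis β f) {a : ℂ} (ha : a ∈ unitDisk) (ha0 : a ≠ 0) : f a ≠ 0 := by
  intro hfa
  obtain ⟨hfh, hf0, hf1⟩ := hf
  obtain ⟨w, hw, hwz⟩ := h
  have h0 : (0 : ℂ) ∈ unitDisk := mem_ball_self one_pos
  have hdf := isHolo_deriv hfh
  have hd0 : deriv f 0 ≠ 0 := by rw [hf1]; exact one_ne_zero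
  have hdne := hdf.eventually_ne_zero h0 hd0 ha
  have hnz : ¬ ∀ᶠ z in 𝓝 a, f z = 0 := fun hz => by
    have h2 := hfh.analyticOnNhd.eqOn_zero_of_preconnected_of_eventuallyEq_zero
      (convex_ball (0 : ℂ) 1).isPreconnected ha hz
    have h3 : f =ᶠ[𝓝 0] fun _ => 0 := by
      filter_upwards [isOpen_ball.mem_nhds h0] with y hy using h2 hy
    rw [h3.deriv_eq] at hd0
    simp at hd0
  have hfan := hfh.analyticOnNhd a ha
  obtain ⟨n, g, hg, hga, hfg⟩ := (hfan.exists_eventuallyEq_pow_smul_nonzero_iff).2 hnz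
  have hn : n ≠ 0 := by
    rintro rfl
    have := hfg.self_of_nhds
    rw [hfa] at this
    simp at this
    exact hga this.symm
  obtain ⟨k, rfl⟩ := Nat.exists_eq_succ_of_ne_zero hn
  -- `R z = (z - a) z f'(z) / f(z)` is analytic at `a`
  set R : ℂ → ℂ := fun z => z * ((k + 1 : ℕ) + (z - a) * (deriv g z / g z)) with hR
  have hRan : AnalyticAt ℂ R a := by
    have := hg.deriv
    have := this.div hg hga
    fun_prop
  have hRa : R a = a * (k + 1 : ℕ) := by simp [hR]
  -- Near a zero a of order k + 1, z(zf'/f)' is z((z - a)R' - R)/(z - a)², a double pole since R(a)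
  -- = (k + 1)a ≠ 0. The hypothesis equates it with the bounded function (φ_Ne(w) - 1)/β;
  -- multiplying by (z - a)²/z and letting z → a gives the contradiction.
  have hlim1 : Tendsto (fun z => (z - a) * deriv R z - R z) (𝓝[≠] a) (𝓝 (-(a * (k + 1 : ℕ)))) := by
    have hc : ContinuousAt (fun z => (z - a) * deriv R z - R z) a := by
      have h1 := hRan.continuousAt
      have h2 := hRan.deriv.continuousAt
      fun_prop
    have := hc.tendsto.mono_left (nhdsWithin_le_nhds (s := {a}ᶜ))
    simpa [hRa] using this
  have hlim2 : Tendsto (fun z => (z - a) ^ 2 * ((phiNe (w z) - 1) / (β * z))) (𝓝[≠] a) (𝓝 0) := by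
    have hwa := (hw.1.differentiableAt_of_mem ha).continuousAt
    have hβC : (β : ℂ) ≠ 0 := by exact_mod_cast hβ.ne'
    have hc : ContinuousAt (fun z => (z - a) ^ 2 * ((phiNe (w z) - 1) / (β * z))) a := by
      unfold phiNe
      have : (β : ℂ) * a ≠ 0 := mul_ne_zero hβC ha0
      fun_prop (disch := assumption)
    have := hc.tendsto.mono_left (nhdsWithin_le_nhds (s := {a}ᶜ))
    simpa using this
  have heq : (fun z => (z - a) * deriv R z - R z) =ᶠ[𝓝[≠] a]
      fun z => (z - a) ^ 2 * ((phiNe (w z) - 1) / (β * z)) := by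
    have e1 : ∀ᶠ z in 𝓝 a, ∀ᶠ y in 𝓝 z, f y = (y - a) ^ (k + 1) • g y := hfg.eventually_nhds
    have e2 : ∀ᶠ z in 𝓝 a, g z ≠ 0 := hg.continuousAt.eventually_ne hga
    have e3 : ∀ᶠ z in 𝓝 a, AnalyticAt ℂ g z := hg.eventually_analyticAt
    have e4 : ∀ᶠ z in 𝓝 a, z ≠ 0 := continuousAt_id.eventually_ne ha0
    have hev : ∀ᶠ z in 𝓝[≠] a, z ∈ unitDisk ∧ z - a ≠ 0 ∧ z ≠ 0 ∧ DifferentiableAt ℂ R z ∧ deriv f z ≠ 0 ∧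
        f z ≠ 0 ∧ z * deriv f z / f z = R z / (z - a) := by
      filter_upwards [nhdsWithin_le_nhds e1, nhdsWithin_le_nhds e2, nhdsWithin_le_nhds e3,
        nhdsWithin_le_nhds e4, nhdsWithin_le_nhds hRan.eventually_analyticAt,
        nhdsWithin_le_nhds (isOpen_ball.mem_nhds ha), self_mem_nhdsWithin,
        hdne] with z z1 z2 z3 z4 z13 z5 z6 z7
      have z12 := z13.differentiableAt
      have z8 : z - a ≠ 0 := sub_ne_zero.2 z6
      have z9 := z1.self_of_nhds
      have z10 : deriv f z = ((k + 1 : ℕ) : ℂ) * (z - a) ^ k * g z + (z - a) ^ (k + 1) * deriv g z := by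
        rw [Filter.EventuallyEq.deriv_eq z1]
        have d := ((((hasDerivAt_id' z).sub_const a).fun_pow (k + 1)).fun_mul
          z3.differentiableAt.hasDerivAt)
        simp only [smul_eq_mul]
        rw [d.deriv]
        simp
      have z11 : f z ≠ 0 := by rw [z9, smul_eq_mul]; exact mul_ne_zero (pow_ne_zero _ z8) z2
      refine ⟨z5, z8, z4, z12, z7, z11, ?_⟩
      rw [z9, z10, smul_eq_mul, hR]
      field_simp
      ring
    filter_upwards [hev, eventually_eventually_nhdsWithin.2 hev, self_mem_nhdsWithin] with z z1 z2 z3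
    rw [isOpen_compl_singleton.nhdsWithin_eq z3] at z2
    obtain ⟨y1, y2, y3, hRz, y5, y6, y7⟩ := z1
    have d1 : deriv (fun z => z * deriv f z / f z) z =
        (deriv R z * (z - a) - R z) / (z - a) ^ 2 := by
      have e : (fun z => z * deriv f z / f z) =ᶠ[𝓝 z] fun z => R z / (z - a) :=
        z2.mono fun y hy => hy.2.2.2.2.2.2
      rw [e.deriv_eq, (hRz.hasDerivAt.fun_div ((hasDerivAt_id' z).sub_const a) y2).deriv, mul_one]
    have d2 := mul_deriv_logQuot hfh y1 y6 y5
    have d3 := hwz z y1 y6 y5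
    have hβC : (β : ℂ) ≠ 0 := by exact_mod_cast hβ.ne'
    have d4 : phiNe (w z) - 1 = β * (z * ((deriv R z * (z - a) - R z) / (z - a) ^ 2)) := by
      rw [← d1, d2]; linear_combination -d3
    rw [d4]
    field_simp
  have := tendsto_nhds_unique (hlim1.congr' heq) hlim2
  rw [neg_eq_zero] at this
  exact mul_ne_zero ha0 (by exact_mod_cast Nat.succ_ne_zero k) this

open Filter Topology in
-- Writing f = zg with g free of zeros, zf'/f = 1 + zg'/g is analytic in the whole disk. The
-- subordination identity holds off the isolated zeros of f and f' and extends to them by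
-- continuity.
lemma subordinate_of_starHypothesis {β : ℝ} (hβ : 0 < β) {f : ℂ → ℂ} (hf : f ∈ ClassA)
    (h : StarHypothesis β f) : IsHolo (starQuot f) ∧
      Subordinate (fun z => 1 + (β : ℂ) * (z * deriv (starQuot f) z)) phiNe := by
  have hne := fun a ha ha0 => ne_zero_of_starHypothesis (a := a) hβ hf h ha ha0
  obtain ⟨hfh, hf0, hf1⟩ := hf
  obtain ⟨w, hw, hwz⟩ := h
  have h0 : (0 : ℂ) ∈ unitDisk := mem_ball_self one_pos
  set g := dslope f 0 with hg
  have hgh : IsHolo g := (Complex.differentiableOn_dslope (isOpen_ball.mem_nhds h0)).2 hfh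
  have hfg : ∀ z, f z = z * g z := fun z => by
    have := sub_smul_dslope f 0 z
    rw [hf0, sub_zero, sub_zero, smul_eq_mul] at this
    exact this.symm
  have hg0 : ∀ z ∈ unitDisk, g z ≠ 0 := fun z hz => by
    rcases eq_or_ne z 0 with rfl | hz0
    · rw [hg, dslope_same, hf1]; exact one_ne_zero
    · intro h1
      exact hne z hz hz0 (by rw [hfg, h1, mul_zero])
  have hdf : ∀ z ∈ unitDisk, deriv f z = g z + z * deriv g z := fun z hz => by
    have d := (hasDerivAt_id' z).fun_mul (hgh.differentiableAt_of_mem hz).hasDerivAt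
    rw [show f = fun z => z * g z from funext hfg, d.deriv, one_mul]
  have hp : ∀ z ∈ unitDisk, starQuot f z = 1 + z * deriv g z / g z := fun z hz => by
    have h1 := hg0 z hz
    rcases eq_or_ne z 0 with rfl | hz0
    · simp [starQuot]
    · rw [starQuot, if_neg hz0, hdf z hz, hfg]
      field_simp
  have hph : IsHolo (starQuot f) := by
    refine DifferentiableOn.congr (fun z hz => ?_) hp
    have h1 := (hgh.differentiableAt_of_mem hz)
    have h2 := ((isHolo_deriv hgh).differentiableAt_of_mem hz)
    have h3 := hg0 z hz
    exact DifferentiableAt.differentiableWithinAt (by fun_prop (disch := assumption))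
  have hsub : IsHolo (fun z => 1 + (β : ℂ) * (z * deriv (starQuot f) z)) :=
    (((differentiableOn_id).fun_mul (isHolo_deriv hph)).const_mul _).const_add 1
  refine ⟨hph, hsub, isHolo_phiNe, w, hw, fun z hz => ?_⟩
  have hhalf : (1 / 2 : ℂ) ∈ unitDisk := by rw [mem_ball_zero_iff]; norm_num
  have e1 := hfh.eventually_ne_zero hhalf (hne _ hhalf (by norm_num)) hz
  have e2 := (isHolo_deriv hfh).eventually_ne_zero h0 (by rw [hf1]; exact one_ne_zero) hz
  have heq : (fun z => 1 + (β : ℂ) * (z * deriv (starQuot f) z)) =ᶠ[𝓝[≠] z]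
      fun z => phiNe (w z) := by
    filter_upwards [e1, e2, nhdsWithin_le_nhds (isOpen_ball.mem_nhds hz)] with y h1 h2 hy
    have hy0 : y ≠ 0 := by rintro rfl; exact h1 hf0
    have e : starQuot f =ᶠ[𝓝 y] fun z => z * deriv f z / f z := by
      filter_upwards [continuousAt_id.eventually_ne hy0] with x hx
      exact if_neg hx
    rw [e.deriv_eq, mul_deriv_logQuot hfh hy h1 h2, ← hwz y hy h1 h2]
    ring
  have hc1 := (hsub.differentiableAt_of_mem hz).continuousAt.tendsto.mono_left
    (nhdsWithin_le_nhds (s := {z}ᶜ))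
  have hc2 : ContinuousAt (fun z => phiNe (w z)) z := by
    have := (hw.1.differentiableAt_of_mem hz).continuousAt
    unfold phiNe
    fun_prop
  exact tendsto_nhds_unique (hc1.congr' heq)
    (hc2.tendsto.mono_left (nhdsWithin_le_nhds (s := {z}ᶜ)))

/-! ### Sharpness and conclusion -/

/-- Both assertions for one function `φ`, given an explicit subordination of the best dominant and
the fact that `φ` omits the value `1 - c` in the disk. -/
theorem sharp_of_subordination {φ : ℂ → ℂ} {c : ℝ} (hc : 0 < c) (hφ : IsHolo φ)
    (hW : ∃ W, IsSchwarz W ∧ ∀ z ∈ unitDisk, 1 + (c : ℂ) * cubicG z = φ (W z))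
    (hne : ∀ {ω}, ω ∈ unitDisk → φ ω ≠ 1 - (c : ℂ)) :
    HoldsWithSharpBound (DiffImplies φ) (8 / (9 * c)) ∧
      HoldsWithSharpBound (StarImplies φ) (8 / (9 * c)) := by
  have hb0 : 0 < 8 / (9 * c) := by positivity
  have hD : ∀ β : ℝ, 8 / (9 * c) ≤ β → DiffImplies φ β := fun β hβ p hp hp0 h => by
    obtain ⟨v, hv, hvz⟩ := exists_schwarz_of_subordinate hp hp0 hc hβ h
    obtain ⟨W, hWs, hWz⟩ := hW
    refine ⟨hp, hφ, fun z => W (v z), hWs.comp hv, fun z hz => ?_⟩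
    rw [hvz z hz, hWz _ (mem_ball_zero_iff.2 (hv.2.2 z hz))]
  have hnot : ∀ β : ℝ, 0 < β → β < 8 / (9 * c) → ∀ q : ℂ → ℂ,
      (∀ z ∈ unitDisk, q z = 1 + (β : ℂ)⁻¹ * (z - z ^ 3 / 9)) → ¬ Subordinate q φ := by
    rintro β hβ0 hβ q hq ⟨-, -, w, hw, hwz⟩
    have hlt : β * c < 8 / 9 := by
      rw [lt_div_iff₀ (by positivity)] at hβ; linarith
    -- t - t³/9 increases from 0 to 8/9 on [0, 1] and βc < 8/9, so some t in (0, 1) has q(-t) = 1 -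
    -- c, the value omitted by φ.
    obtain ⟨t, ht, htc⟩ := intermediate_value_Ioo (zero_le_one' ℝ)
      (f := fun t => t - t ^ 3 / 9) (by fun_prop)
      (show β * c ∈ Ioo _ _ by constructor <;> norm_num <;> first | positivity | linarith)
    have hmem : ((-t : ℝ) : ℂ) ∈ unitDisk := by
      rw [mem_ball_zero_iff, Complex.norm_real, Real.norm_eq_abs, abs_neg, abs_of_pos ht.1]
      exact ht.2
    refine hne (mem_ball_zero_iff.2 (hw.2.2 _ hmem)) ?_
    rw [← hwz _ hmem, hq _ hmem]
    have h1 : (t : ℂ) - t ^ 3 / 9 = β * c := by exact_mod_cast htc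
    have hβC : (β : ℂ) ≠ 0 := by exact_mod_cast hβ0.ne'
    push_cast
    field_simp
    linear_combination -9 * h1
  have hder : ∀ (β : ℂ) (z : ℂ), HasDerivAt (fun z : ℂ => 1 + β⁻¹ * (z - z ^ 3 / 9))
      (β⁻¹ * (1 - z ^ 2 / 3)) z := fun β z => by
    have := (((hasDerivAt_id' z).fun_sub ((hasDerivAt_pow 3 z).div_const 9)).const_mul
      β⁻¹).const_add 1
    exact this.congr_deriv (by push_cast; ring)
  refine ⟨⟨hD, fun β hβ0 hβ h => ?_⟩, fun β hβ f hf h => ?_, fun β hβ0 hβ h => ?_⟩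
  · have hβC : (β : ℂ) ≠ 0 := by exact_mod_cast hβ0.ne'
    have hqh : IsHolo (fun z : ℂ => 1 + (β : ℂ)⁻¹ * (z - z ^ 3 / 9)) :=
      fun z _ => (hder β z).differentiableAt.differentiableWithinAt
    have e : (fun z => 1 + (β : ℂ) * (z * deriv (fun z : ℂ => 1 + (β : ℂ)⁻¹ * (z - z ^ 3 / 9)) z))
        = phiNe := by
      ext z
      rw [(hder β z).deriv, phiNe]
      field_simp
      ring
    refine hnot β hβ0 hβ _ (fun z _ => rfl) (h _ hqh (by simp) ?_)
    rw [e]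
    exact ⟨isHolo_phiNe, isHolo_phiNe, id, ⟨differentiableOn_id, rfl,
      fun z hz => mem_ball_zero_iff.1 hz⟩, fun z _ => rfl⟩
  · obtain ⟨h1, h2⟩ := subordinate_of_starHypothesis (hb0.trans_le hβ) hf h
    exact ⟨hf, hD β hβ _ h1 (by simp [starQuot]) h2⟩
  · have hβC : (β : ℂ) ≠ 0 := by exact_mod_cast hβ0.ne'
    -- The extremal function is f = zE: the coefficient 1/27 is chosen so that zf'/f = 1 + zE'/E
    -- equals q.
    set E : ℂ → ℂ := fun z => Complex.exp ((β : ℂ)⁻¹ * (z - z ^ 3 / 27)) with hE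
    set q : ℂ → ℂ := fun z => 1 + (β : ℂ)⁻¹ * (z - z ^ 3 / 9) with hq
    have hE0 : ∀ z, E z ≠ 0 := fun z => Complex.exp_ne_zero _
    have dE : ∀ z, HasDerivAt E (E z * ((β : ℂ)⁻¹ * (1 - z ^ 2 / 9))) z := fun z => by
      have := (((hasDerivAt_id' z).fun_sub ((hasDerivAt_pow 3 z).div_const 27)).const_mul
        (β : ℂ)⁻¹).cexp
      exact this.congr_deriv (by push_cast; ring)
    have df : ∀ z, HasDerivAt (fun z => z * E z) (E z * q z) z := fun z =>
      ((hasDerivAt_id' z).fun_mul (dE z)).congr_deriv (by simp only [hq]; ring)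
    have hdf : deriv (fun z => z * E z) = fun z => E z * q z := funext fun z => (df z).deriv
    have hfh : IsHolo (fun z => z * E z) := fun z _ => (df z).differentiableAt.differentiableWithinAt
    have hfA : (fun z => z * E z) ∈ ClassA := ⟨hfh, by simp, by rw [hdf]; simp [hE, hq]⟩
    have hquot : ∀ z, z ≠ 0 → z * (E z * q z) / (z * E z) = q z := fun z hz => by
      have := hE0 z
      field_simp
    refine hnot β hβ0 hβ (starQuot fun z => z * E z) (fun z _ => ?_) (h _ hfA ?_).2
    · rcases eq_or_ne z 0 with rfl | hz
      · simp [starQuot]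
      · rw [starQuot, if_neg hz, hdf, hquot z hz]
    · refine ⟨id, ⟨differentiableOn_id, rfl, fun z hz => mem_ball_zero_iff.1 hz⟩,
        fun z hz h1 h2 => ?_⟩
      have hz0 : z ≠ 0 := by rintro rfl; simp at h1
      have h3 := mul_deriv_logQuot hfh hz h1 h2
      have e : (fun y => y * deriv (fun z => z * E z) y / (y * E y)) =ᶠ[nhds z] q := by
        filter_upwards [continuousAt_id.eventually_ne hz0] with x hx
        rw [hdf]
        exact hquot x hx
      rw [e.deriv_eq, (hder β z).deriv] at h3
      rw [mul_assoc, ← h3, phiNe, id]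
      field_simp
      ring

end Nephroid

theorem mainTheorem5 :
    (Nephroid.HoldsWithSharpBound (Nephroid.DiffImplies Nephroid.phiCrescent)
        (4 / 9 * (2 + √2)) ∧
      Nephroid.HoldsWithSharpBound (Nephroid.DiffImplies Nephroid.phiC) (4 / 3) ∧
      Nephroid.HoldsWithSharpBound (Nephroid.DiffImplies Nephroid.phiLim)
        (16 / 63 * (1 + 2 * √2)) ∧
      Nephroid.HoldsWithSharpBound (Nephroid.DiffImplies Complex.exp)
        (8 * Real.exp 1 / (9 * (Real.exp 1 - 1))) ∧
      Nephroid.HoldsWithSharpBound (Nephroid.DiffImplies Nephroid.phiS)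
        (8 / (9 * Real.sin 1)) ∧
      Nephroid.HoldsWithSharpBound (Nephroid.DiffImplies Nephroid.phiR)
        (8 / 9 * (3 + 2 * √2)) ∧
      Nephroid.HoldsWithSharpBound (Nephroid.DiffImplies Nephroid.phiNe) (4 / 3)) ∧
    (Nephroid.HoldsWithSharpBound (Nephroid.StarImplies Nephroid.phiCrescent)
        (8 / (9 * (2 - √2))) ∧
      Nephroid.HoldsWithSharpBound (Nephroid.StarImplies Nephroid.phiC) (4 / 3) ∧
      Nephroid.HoldsWithSharpBound (Nephroid.StarImplies Nephroid.phiLim)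
        (16 / (9 * (2 * √2 - 1))) ∧
      Nephroid.HoldsWithSharpBound (Nephroid.StarImplies Complex.exp)
        (8 * Real.exp 1 / (9 * (Real.exp 1 - 1))) ∧
      Nephroid.HoldsWithSharpBound (Nephroid.StarImplies Nephroid.phiS)
        (8 / (9 * Real.sin 1)) ∧
      Nephroid.HoldsWithSharpBound (Nephroid.StarImplies Nephroid.phiR)
        (8 / 9 * (3 + 2 * √2)) ∧
      Nephroid.HoldsWithSharpBound (Nephroid.StarImplies Nephroid.phiNe) (4 / 3)) := by
  have hq := Real.sq_sqrt (show (0 : ℝ) ≤ 2 by norm_num)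
  obtain ⟨hq1, hq2⟩ := Nephroid.sqrt_two_bounds
  have he : Real.exp 1 - 1 ≠ 0 := by simp [sub_eq_zero]
  -- Each bound is rewritten as 8/(9c) with c = 1 - φ(-1).
  have b1 : (4 / 9 * (2 + √2) : ℝ) = 8 / (9 * (2 - √2)) := by
    rw [eq_div_iff (by nlinarith)]; linear_combination -4 * hq
  have b2 : (4 / 3 : ℝ) = 8 / (9 * (2 / 3)) := by norm_num
  have b3 : (16 / 63 * (1 + 2 * √2) : ℝ) = 8 / (9 * (√2 - 1 / 2)) := by
    rw [eq_div_iff (by nlinarith)]; linear_combination (32 / 7) * hq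
  have b3' : (16 / (9 * (2 * √2 - 1)) : ℝ) = 8 / (9 * (√2 - 1 / 2)) := by
    rw [div_eq_div_iff (by nlinarith) (by nlinarith)]; ring
  have b4 : 8 * Real.exp 1 / (9 * (Real.exp 1 - 1)) = 8 / (9 * (1 - (Real.exp 1)⁻¹)) := by
    have := Real.exp_ne_zero 1
    field_simp
  have b6 : (8 / 9 * (3 + 2 * √2) : ℝ) = 8 / (9 * (3 - 2 * √2)) := by
    rw [eq_div_iff (by nlinarith)]; linear_combination -32 * hq
  have h1 := Nephroid.sharp_of_subordination (by linarith) Nephroid.isHolo_phiCrescent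
    Nephroid.exists_schwarz_phiCrescent Nephroid.phiCrescent_ne
  have h2 := Nephroid.sharp_of_subordination (by norm_num) Nephroid.isHolo_phiC
    Nephroid.exists_schwarz_phiC Nephroid.phiC_ne
  have h3 := Nephroid.sharp_of_subordination (by linarith) Nephroid.isHolo_phiLim
    Nephroid.exists_schwarz_phiLim Nephroid.phiLim_ne
  have h4 := Nephroid.sharp_of_subordination Nephroid.one_sub_inv_exp_mem.1
    Complex.differentiable_exp.differentiableOn Nephroid.exists_schwarz_exp Nephroid.exp_ne
  have h5 := Nephroid.sharp_of_subordination (by linarith [Nephroid.sin_one_bounds.1])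
    Nephroid.isHolo_phiS Nephroid.exists_schwarz_phiS Nephroid.phiS_ne
  have h6 := Nephroid.sharp_of_subordination (by linarith) Nephroid.isHolo_phiR
    Nephroid.exists_schwarz_phiR Nephroid.phiR_ne
  have h7 := Nephroid.sharp_of_subordination (by norm_num) Nephroid.isHolo_phiNe
    Nephroid.exists_schwarz_phiNe Nephroid.phiNe_ne
  rw [b1, b2, b3, b3', b4, b6]
  exact ⟨⟨h1.1, h2.1, h3.1, h4.1, h5.1, h6.1, h7.1⟩, h1.2, h2.2, h3.2, h4.2, h5.2, h6.2, h7.2⟩
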